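/- Let $X\in\mathbb R^{n\times p}$ have rows $x_1,\dots,x_n$, let $y\in\{0,1\}^n$, and consider Bayesian logistic regression with prior $\beta\sim\mathcal N(m_0,Q_0^{-1})$, $Q_0\succ0$. Let $\mathrm{PG}(1,c)$ be the Pólya–Gamma law, i.e. the law of $\frac1{2\pi^2}\sum_{k\ge1}\frac{g_k}{(k-1/2)^2+c^2/(4\pi^2)}$ with $g_k$ i.i.d. $\mathrm{Gamma}(1,1)$. The Pólya–Gamma CAVI scheme (the Jaakkola–Jordan algorithm) is $\nu_{k+1}=\nu_\star[\mu_\star[\nu_k]]$, where $$\mu_\star[\nu]=\bigotimes_{i=1}^n\mathrm{PG}(1,c_{i,\nu}),\quad c_{i,\nu}=\big(\mathbb E_\nu[(x_i^\top\beta)^2]\big)^{1/2},\qquad \nu_\star[\mu]=\mathcal N(Q_\mu^{-1}m,\,Q_\mu^{-1}),$$ $$Q_\mu=X^\top\mathrm{diag}(\mathbb E_\mu[Z_i])X+Q_0,\qquad m=X^\top(y-\tfrac12)+Q_0m_0 .$$ Let $\nu_\star$ be any fixed point, $\nu_\star=\nu_\star[\mu_\star]$ with $\mu_\star=\mu_\star[\nu_\star]$,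 and put $c_{i,\star}=c_{i,\nu_\star}$, $Q_\star=Q_{\mu_\star}$. Let $\mathbb W_2$ be the Wasserstein-2 distance on $\mathbb R^p$ for the norm $|v|^2=v^\top Q_\star v$. Put $\varphi(c)=\tanh(c/2)/(2c)$ for $c\neq0$, $\varphi(0)=1/4$; for $c\in\mathbb R^n$ put $Q(c)=X^\top\mathrm{diag}(\varphi(c_i))X+Q_0$, $m(c)=Q(c)^{-1}m$, $S(c)=Q(c)^{-1}+m(c)m(c)^\top$. For $\varepsilon>0$ let $$J_{i,\varepsilon}=\Big[\big(c_{i,\star}-\sqrt{x_i^\top Q_\star^{-1}x_i}\,\varepsilon\big)_+,\ c_{i,\star}+\sqrt{x_i^\top Q_\star^{-1}x_i}\,\varepsilon\Big],$$ $$a_i=\frac{\sup\big\{|\varphi'(\xi)|^2\,x_i^\top S(c)\,x_i:\ \xi\in J_{i,\varepsilon},\ c\in\prod_{j=1}^nJ_{j,\varepsilon}\big\}}{\varphi(c_{i,\star})},\qquad A_\varepsilon=Q_\star^{-1/2}X^\top\mathrm{diag}(a_i)\,X\,Q_\star^{-1/2},\qquad r_\varepsilon=\lambda_{\max}(A_\varepsilon).$$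 Suppose that $r_\varepsilon<1$ and that $\nu_0$ is an absolutely continuous probability measure on $\mathbb R^p$ with finite second moment and $\mathbb W_2(\nu_0,\nu_\star)<\varepsilon$. Then, for all $k\ge0$, $$\mathbb W_2^2(\nu_{k+1},\nu_\star)\le r_\varepsilon\,\mathbb W_2^2(\nu_k,\nu_\star)\qquad\text{and hence}\qquad \mathbb W_2^2(\nu_k,\nu_\star)\le r_\varepsilon^{\,k}\,\mathbb W_2^2(\nu_0,\nu_\star),$$ i.e. the iterates converge to $\nu_\star$ exponentially fast in Wasserstein-2 distance, with squared distance contracting at rate $r_\varepsilon$. -/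

import Mathlib

open MeasureTheory ProbabilityTheory Matrix
open scoped ENNReal MatrixOrder

namespace LogitCAVI

noncomputable section

/-- The law `PG(b, c)`: the distribution of
`(1 / (2 π²)) * ∑_{k ≥ 1} g_k / ((k - 1/2)² + c² / (4 π²))` with `g_k` i.i.d. `Gamma(b, 1)`.
The sum is indexed from `k = 0` here, so that `k - 1/2` becomes `k + 1/2`. -/
def polyaGamma (b c : ℝ) : Measure ℝ :=
  (Measure.infinitePi (fun _ : ℕ => gammaMeasure b 1)).map
    (fun g : ℕ → ℝ => 1 / (2 * Real.pi ^ 2) *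
      ∑' k : ℕ, g k / (((k : ℝ) + 1 / 2) ^ 2 + c ^ 2 / (4 * Real.pi ^ 2)))

/-- `φ(c) = tanh (c / 2) / (2 c)`, extended by continuity by `φ(0) = 1 / 4`. -/
def phi (c : ℝ) : ℝ := if c = 0 then 1 / 4 else Real.tanh (c / 2) / (2 * c)

/-- The largest eigenvalue of a real symmetric matrix. -/
def lambdaMax {p : ℕ} (A : Matrix (Fin p) (Fin p) ℝ) : ℝ := sSup (spectrum ℝ A)

/-- The squared length `vᵀ B v` of `v` in the geometry induced by `B`. -/
def sqNormOf {p : ℕ} (B : Matrix (Fin p) (Fin p) ℝ) (v : EuclideanSpace ℝ (Fin p)) : ℝ :=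
  v.ofLp ⬝ᵥ (B *ᵥ v.ofLp)

/-- The set of couplings of two measures. -/
def couplings {p : ℕ} (ν ρ : Measure (EuclideanSpace ℝ (Fin p))) :
    Set (Measure (EuclideanSpace ℝ (Fin p) × EuclideanSpace ℝ (Fin p))) :=
  {γ | γ.fst = ν ∧ γ.snd = ρ}

/-- The Wasserstein-2 distance on `ℝᵖ` with the distance `d(x, y)² = (x - y)ᵀ B (x - y)`. -/
def wasserstein2 {p : ℕ} (B : Matrix (Fin p) (Fin p) ℝ)
    (ν ρ : Measure (EuclideanSpace ℝ (Fin p))) : ℝ≥0∞ :=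
  (⨅ γ ∈ couplings ν ρ, ∫⁻ z, ENNReal.ofReal (sqNormOf B (z.1 - z.2)) ∂γ) ^ (1 / 2 : ℝ)

/-- Absolutely continuous probability measures on `ℝᵖ` with finite second moment. -/
def P2 (p : ℕ) : Set (Measure (EuclideanSpace ℝ (Fin p))) :=
  {ν | IsProbabilityMeasure ν ∧ ν ≪ volume ∧ Integrable (fun β => ‖β‖ ^ 2) ν}

/-- The ball `B(ε)` in `P2` around `νs`, for the Wasserstein-2 distance in the geometry `B`. -/
def ball {p : ℕ} (B : Matrix (Fin p) (Fin p) ℝ) (νs : Measure (EuclideanSpace ℝ (Fin p)))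
    (ε : ℝ) : Set (Measure (EuclideanSpace ℝ (Fin p))) :=
  {ν | ν ∈ P2 p ∧ wasserstein2 B ν νs < ENNReal.ofReal ε}

variable {n p : ℕ}

/-- `Xᵀ diag(w) X + Q₀`. -/
def precision (X : Matrix (Fin n) (Fin p) ℝ) (Q0 : Matrix (Fin p) (Fin p) ℝ) (w : Fin n → ℝ) :
    Matrix (Fin p) (Fin p) ℝ :=
  Xᵀ * diagonal w * X + Q0

/-- `m = Xᵀ (y - 1/2) + Q₀ m₀`. -/
def shift (X : Matrix (Fin n) (Fin p) ℝ) (y : Fin n → ℝ) (m0 : Fin p → ℝ)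
    (Q0 : Matrix (Fin p) (Fin p) ℝ) : Fin p → ℝ :=
  Xᵀ *ᵥ (fun i => y i - 1 / 2) + Q0 *ᵥ m0

/-- `Q_μ = Xᵀ diag(E_μ[Z_i]) X + Q₀`. -/
def precisionOf (X : Matrix (Fin n) (Fin p) ℝ) (Q0 : Matrix (Fin p) (Fin p) ℝ)
    (μ : Measure (Fin n → ℝ)) : Matrix (Fin p) (Fin p) ℝ :=
  precision X Q0 (fun i => ∫ z, z i ∂μ)

/-- `c_{i,ν} = (E_ν[(x_iᵀ β)²])^{1/2}`. -/
def tilt (X : Matrix (Fin n) (Fin p) ℝ) (ν : Measure (EuclideanSpace ℝ (Fin p))) (i : Fin n) : ℝ :=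
  Real.sqrt (∫ β, (X i ⬝ᵥ β.ofLp) ^ 2 ∂ν)

/-- The update `ν⋆[μ] = N(Q_μ⁻¹ m, Q_μ⁻¹)`. -/
def nuStar (X : Matrix (Fin n) (Fin p) ℝ) (y : Fin n → ℝ) (m0 : Fin p → ℝ)
    (Q0 : Matrix (Fin p) (Fin p) ℝ) (μ : Measure (Fin n → ℝ)) :
    Measure (EuclideanSpace ℝ (Fin p)) :=
  multivariateGaussian (WithLp.toLp 2 ((precisionOf X Q0 μ)⁻¹ *ᵥ shift X y m0 Q0))
    (precisionOf X Q0 μ)⁻¹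

/-- The update `μ⋆[ν] = ⨂ᵢ PG(1, c_{i,ν})`. -/
def muStar (X : Matrix (Fin n) (Fin p) ℝ) (ν : Measure (EuclideanSpace ℝ (Fin p))) :
    Measure (Fin n → ℝ) :=
  Measure.pi (fun i => polyaGamma 1 (tilt X ν i))

/-- The `ν`-iterates `ν_{k+1} = ν⋆[μ⋆[ν_k]]` started at `ν0`. -/
def iterate (X : Matrix (Fin n) (Fin p) ℝ) (y : Fin n → ℝ) (m0 : Fin p → ℝ)
    (Q0 : Matrix (Fin p) (Fin p) ℝ) (ν0 : Measure (EuclideanSpace ℝ (Fin p))) :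
    ℕ → Measure (EuclideanSpace ℝ (Fin p))
  | 0 => ν0
  | k + 1 => nuStar X y m0 Q0 (muStar X (iterate X y m0 Q0 ν0 k))

/-- `S(c) = Q(c)⁻¹ + m(c) m(c)ᵀ`, where `Q(c) = Xᵀ diag(φ(c_i)) X + Q₀` and `m(c) = Q(c)⁻¹ m`. -/
def secondMoment (X : Matrix (Fin n) (Fin p) ℝ) (y : Fin n → ℝ) (m0 : Fin p → ℝ)
    (Q0 : Matrix (Fin p) (Fin p) ℝ) (c : Fin n → ℝ) : Matrix (Fin p) (Fin p) ℝ :=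
  (precision X Q0 (fun i => phi (c i)))⁻¹ +
    vecMulVec ((precision X Q0 (fun i => phi (c i)))⁻¹ *ᵥ shift X y m0 Q0)
      ((precision X Q0 (fun i => phi (c i)))⁻¹ *ᵥ shift X y m0 Q0)

/-- `Q⋆ = Q_{μ⋆}` with `μ⋆ = μ⋆[ν⋆]`, for a fixed point `νs = ν⋆`. -/
def precisionStar (X : Matrix (Fin n) (Fin p) ℝ) (Q0 : Matrix (Fin p) (Fin p) ℝ)
    (νs : Measure (EuclideanSpace ℝ (Fin p))) : Matrix (Fin p) (Fin p) ℝ :=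
  precisionOf X Q0 (muStar X νs)

/-- The interval `J_{i,ε}` with end points `(c_{i,⋆} - √(x_iᵀ Q⋆⁻¹ x_i) ε)₊` and
`c_{i,⋆} + √(x_iᵀ Q⋆⁻¹ x_i) ε`. -/
def J (X : Matrix (Fin n) (Fin p) ℝ) (Q0 : Matrix (Fin p) (Fin p) ℝ)
    (νs : Measure (EuclideanSpace ℝ (Fin p))) (ε : ℝ) (i : Fin n) : Set ℝ :=
  Set.Icc
    (max (tilt X νs i - Real.sqrt (X i ⬝ᵥ ((precisionStar X Q0 νs)⁻¹ *ᵥ X i)) * ε) 0)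
    (tilt X νs i + Real.sqrt (X i ⬝ᵥ ((precisionStar X Q0 νs)⁻¹ *ᵥ X i)) * ε)

/-- The weight `sup |φ'|² x_iᵀ S x_i / φ(c_{i,⋆})`. The scalar argument `ξ` of `φ'` ranges over
`J_{i,ε}` and the vector argument `c` of `S` ranges over the box `∏ⱼ J_{j,ε}`. -/
def weight (X : Matrix (Fin n) (Fin p) ℝ) (y : Fin n → ℝ) (m0 : Fin p → ℝ)
    (Q0 : Matrix (Fin p) (Fin p) ℝ) (νs : Measure (EuclideanSpace ℝ (Fin p))) (ε : ℝ)
    (i : Fin n) : ℝ :=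
  sSup {t : ℝ | ∃ ξ ∈ J X Q0 νs ε i, ∃ c : Fin n → ℝ, (∀ j, c j ∈ J X Q0 νs ε j) ∧
      t = |deriv phi ξ| ^ 2 * (X i ⬝ᵥ (secondMoment X y m0 Q0 c *ᵥ X i))} /
    phi (tilt X νs i)

/-- `A_ε = Q⋆^{-1/2} Xᵀ diag(weight) X Q⋆^{-1/2}`. -/
def rateMatrix (X : Matrix (Fin n) (Fin p) ℝ) (y : Fin n → ℝ) (m0 : Fin p → ℝ)
    (Q0 : Matrix (Fin p) (Fin p) ℝ) (νs : Measure (EuclideanSpace ℝ (Fin p))) (ε : ℝ) :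
    Matrix (Fin p) (Fin p) ℝ :=
  CFC.sqrt (precisionStar X Q0 νs)⁻¹ * Xᵀ * diagonal (weight X y m0 Q0 νs ε) * X *
    CFC.sqrt (precisionStar X Q0 νs)⁻¹

/-- `r_ε = λ_max(A_ε)`. -/
def rate (X : Matrix (Fin n) (Fin p) ℝ) (y : Fin n → ℝ) (m0 : Fin p → ℝ)
    (Q0 : Matrix (Fin p) (Fin p) ℝ) (νs : Measure (EuclideanSpace ℝ (Fin p))) (ε : ℝ) : ℝ :=
  lambdaMax (rateMatrix X y m0 Q0 νs ε)

end

end LogitCAVI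

namespace LogitCAVI

/-! The mean of `PG(1, c)` is `φ(c)`, so one update of the scheme sees `ν` only through the vector
of tilts `c_{i,ν}` and returns the Gaussian with precision `Q(c)` and mean `Q(c)⁻¹ m`. The
contraction then chains four estimates in the geometry of `Q⋆`.

Transport by information. Two such Gaussians share the vector `m`, so the difference of their scores
is the linear map `β ↦ -(Q(c) - Q⋆) β`. An explicit coupling bounds the squared distance by the mean
of its squared `Q⋆⁻¹` norm (`wasserstein2_sq_gaussian_le`). Since `Xᵀ diag(φ(c⋆)) X ≤ Q⋆`, duality
bounds this by `∑ (φ(c_i) - φ(c_{i,⋆}))² / φ(c_{i,⋆}) * x_iᵀ S(c) x_i`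
(`wasserstein2_sq_gaussianOf_le`).

Mean value theorem. While the tilts stay in the intervals `J_{i,ε}`, this sum is at most `∑ a_i (c_i
- c_{i,⋆})²`.

Minkowski. A tilt is an `L²` norm, so `(c_i - c_{i,⋆})²` is at most the mean of `(x_iᵀ(β - β'))²`
under every coupling of `ν` with `ν⋆`.

Spectrum. `∑ a_i (x_iᵀ v)² ≤ r_ε vᵀ Q⋆ v`; the infimum over couplings closes one step. By
Cauchy–Schwarz a measure within `ε` of `ν⋆` has its tilts in the `J_{i,ε}`, and `r_ε < 1` keeps the
iterates there, so induction applies. -/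

/-! ### Series for `φ` and its derivative -/

/-- The Mittag-Leffler expansion of the cotangent at the imaginary point `iτ`, multiplied by `i`. -/
theorem hasSum_coth_series {τ : ℝ} (hτ : τ ≠ 0) :
    HasSum (fun n : ℕ => 2 * τ / (τ ^ 2 + ((n : ℝ) + 1) ^ 2))
      (Real.pi * (Real.cosh (Real.pi * τ) / Real.sinh (Real.pi * τ)) - 1 / τ) := by
  have hx : (Complex.I * τ : ℂ) ∈ Complex.integerComplement := by
    rw [Complex.mem_integerComplement_iff]
    rintro ⟨n, hn⟩
    have := congrArg Complex.im hn
    simp at this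
    exact hτ this.symm
  have h := (Summable.hasSum_iff (summable_cotTerm hx)).2 (cot_series_rep' hx).symm
  have h2 := h.mul_left Complex.I
  rw [← Complex.hasSum_ofReal]
  have hτ' : (τ : ℂ) ≠ 0 := by exact_mod_cast hτ
  have hs : Complex.sinh (Real.pi * τ) ≠ 0 := by
    have : Real.sinh (Real.pi * τ) ≠ 0 := by
      rw [Ne, Real.sinh_eq_zero]
      exact mul_ne_zero Real.pi_ne_zero hτ
    exact_mod_cast this
  convert! h2 using 1
  · funext n
    rw [cotTerm_identity hx n]
    have hn : (τ : ℂ) ^ 2 + (n + 1) ^ 2 ≠ 0 := by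
      have : τ ^ 2 + ((n : ℝ) + 1) ^ 2 ≠ 0 := by positivity
      exact_mod_cast this
    have e : (Complex.I * τ + (n + 1)) * (Complex.I * τ - (n + 1)) =
        -((τ : ℂ) ^ 2 + (n + 1) ^ 2) := by
      ring_nf
      rw [Complex.I_sq]
      ring
    rw [e]
    push_cast
    field_simp
    rw [Complex.I_sq]
    ring
  · rw [show (Real.pi : ℂ) * (Complex.I * τ) = (Real.pi * τ) * Complex.I by ring,
      Complex.cot, Complex.cos_mul_I, Complex.sin_mul_I]
    push_cast
    field_simp

/-- Twice the `coth` series at `2τ` splits by parity: one half is the `coth` series at `τ`, the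
other is the series wanted. The value follows from `2 coth 2x - coth x = tanh x`. -/
theorem hasSum_tanh_series {τ : ℝ} (hτ : τ ≠ 0) :
    HasSum (fun k : ℕ => 2 * τ / (((k : ℝ) + 1 / 2) ^ 2 + τ ^ 2))
      (Real.pi * Real.tanh (Real.pi * τ)) := by
  have hA := hasSum_coth_series hτ
  have hB := (hasSum_coth_series (mul_ne_zero two_ne_zero hτ)).mul_left 2
  have hodd : (fun k : ℕ => 2 * (2 * (2 * τ) / ((2 * τ) ^ 2 + (((2 * k + 1 : ℕ) : ℝ) + 1) ^ 2))) =
      fun n : ℕ => 2 * τ / (τ ^ 2 + ((n : ℝ) + 1) ^ 2) := by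
    funext k
    push_cast
    field_simp
    ring
  have heven : (fun k : ℕ => 2 * (2 * (2 * τ) / ((2 * τ) ^ 2 + (((2 * k : ℕ) : ℝ) + 1) ^ 2))) =
      fun k : ℕ => 2 * τ / (((k : ℝ) + 1 / 2) ^ 2 + τ ^ 2) := by
    funext k
    push_cast
    field_simp
    ring
  have hsum : Summable fun k : ℕ => 2 * τ / (((k : ℝ) + 1 / 2) ^ 2 + τ ^ 2) := by
    rw [← heven]
    exact hB.summable.comp_injective (mul_right_injective₀ (two_ne_zero' ℕ))
  have key := (HasSum.even_add_odd (heven ▸ hsum.hasSum) (hodd ▸ hA)).unique hB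
  have hs : Real.sinh (Real.pi * τ) ≠ 0 := by
    rw [Ne, Real.sinh_eq_zero]
    exact mul_ne_zero Real.pi_ne_zero hτ
  have hc : Real.cosh (Real.pi * τ) ≠ 0 := (Real.cosh_pos _).ne'
  rw [heven] at key
  convert! hsum.hasSum using 1
  rw [eq_sub_of_add_eq key, show Real.pi * (2 * τ) = 2 * (Real.pi * τ) by ring, Real.cosh_two_mul,
    Real.sinh_two_mul, Real.tanh_eq_sinh_div_cosh]
  field_simp
  ring

theorem hasSum_inv_half_integer_sq :
    HasSum (fun k : ℕ => 1 / ((k : ℝ) + 1 / 2) ^ 2) (Real.pi ^ 2 / 2) := by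
  have h := hasSum_zeta_two
  have ho : Summable fun k : ℕ => 1 / ((2 * k + 1 : ℕ) : ℝ) ^ 2 :=
    h.summable.comp_injective (i := fun k : ℕ => 2 * k + 1) (fun a b hab => by simpa using hab)
  -- The terms at index `0` are `1 / 0 = 0`, so they do not disturb the splitting of `ζ(2)` by
  -- parity.
  have he : HasSum (fun k : ℕ => 1 / ((2 * k : ℕ) : ℝ) ^ 2) (1 / 4 * (Real.pi ^ 2 / 6)) := by
    convert! h.mul_left (1 / 4) using 2 with k
    push_cast
    rw [mul_pow]
    ring
  have key : 1 / 4 * (Real.pi ^ 2 / 6) + ∑' k : ℕ, 1 / ((2 * k + 1 : ℕ) : ℝ) ^ 2 =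
      Real.pi ^ 2 / 6 :=
    (HasSum.even_add_odd (f := fun n : ℕ => 1 / (n : ℝ) ^ 2) he ho.hasSum).unique h
  have : HasSum (fun k : ℕ => 4 * (1 / ((2 * k + 1 : ℕ) : ℝ) ^ 2)) (Real.pi ^ 2 / 2) := by
    convert! ho.hasSum.mul_left 4 using 1
    linarith
  convert! this using 2 with k
  push_cast
  field_simp
  norm_num

/-- The coefficient of the `k`-th Gamma variable in the series defining `PG(b, c)`. -/
noncomputable def pgCoeff (k : ℕ) (c : ℝ) : ℝ :=
  1 / (((k : ℝ) + 1 / 2) ^ 2 + c ^ 2 / (4 * Real.pi ^ 2))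

theorem pgCoeff_pos (k : ℕ) (c : ℝ) : 0 < pgCoeff k c := by
  unfold pgCoeff
  positivity

theorem hasSum_pgCoeff (c : ℝ) : HasSum (fun k => pgCoeff k c) (2 * Real.pi ^ 2 * phi c) := by
  unfold pgCoeff phi
  split_ifs with hc
  · subst hc
    convert! hasSum_inv_half_integer_sq using 1
    · simp
    · ring
  · have hτ : c / (2 * Real.pi) ≠ 0 := div_ne_zero hc (by positivity)
    have hpi := Real.pi_ne_zero
    convert! (hasSum_tanh_series hτ).mul_left (1 / (2 * (c / (2 * Real.pi)))) using 1
    · funext k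
      rw [div_pow]
      field_simp
      ring
    · rw [show Real.pi * (c / (2 * Real.pi)) = c / 2 by field_simp]
      field_simp

theorem phi_pos (c : ℝ) : 0 < phi c := by
  have h := (hasSum_pgCoeff c).summable.tsum_pos (fun k => (pgCoeff_pos k c).le) 0 (pgCoeff_pos 0 c)
  rw [(hasSum_pgCoeff c).tsum_eq] at h
  exact pos_of_mul_pos_right h (by positivity)

theorem hasDerivAt_pgCoeff (k : ℕ) (c : ℝ) :
    HasDerivAt (pgCoeff k) (-(c / (2 * Real.pi ^ 2)) * pgCoeff k c ^ 2) c := by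
  have h0 : ((k : ℝ) + 1 / 2) ^ 2 + c ^ 2 / (4 * Real.pi ^ 2) ≠ 0 := by positivity
  have h : HasDerivAt (fun c : ℝ => ((k : ℝ) + 1 / 2) ^ 2 + c ^ 2 / (4 * Real.pi ^ 2))
      (2 * c / (4 * Real.pi ^ 2)) c := by
    simpa using ((hasDerivAt_pow 2 c).div_const (4 * Real.pi ^ 2)).const_add
      (((k : ℝ) + 1 / 2) ^ 2)
  have h2 := h.inv h0
  have e : pgCoeff k = (fun c : ℝ => ((k : ℝ) + 1 / 2) ^ 2 + c ^ 2 / (4 * Real.pi ^ 2))⁻¹ := by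
    funext c
    simp [pgCoeff]
  rw [e]
  convert! h2 using 1
  change _ * (((k : ℝ) + 1 / 2) ^ 2 + c ^ 2 / (4 * Real.pi ^ 2))⁻¹ ^ 2 = _
  field_simp
  ring

/-- A summable majorant independent of `c`: it permits termwise differentiation of the series and
also bounds `φ'` globally. -/
theorem abs_deriv_pgCoeff_le (k : ℕ) (c : ℝ) :
    ‖-(c / (2 * Real.pi ^ 2)) * pgCoeff k c ^ 2‖ ≤ 2 * (1 / ((k : ℝ) + 1 / 2) ^ 2) := by
  set τ := |c| / (2 * Real.pi) with hτ
  set s := (k : ℝ) + 1 / 2 with hs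
  have hpi : (1 : ℝ) ≤ Real.pi := by linarith [Real.pi_gt_three]
  have hs2 : 1 / 2 ≤ s := by rw [hs]; linarith [(Nat.cast_nonneg k : (0 : ℝ) ≤ k)]
  have hs0 : 0 < s := by linarith
  have hτ0 : 0 ≤ τ := by positivity
  have e1 : pgCoeff k c = 1 / (s ^ 2 + τ ^ 2) := by
    rw [pgCoeff, hτ, hs, div_pow, sq_abs, mul_pow]
    norm_num
  have e2 : |c| / (2 * Real.pi ^ 2) = τ / Real.pi := by
    rw [hτ]
    field_simp
  rw [Real.norm_eq_abs, abs_mul, abs_neg, abs_div, abs_of_pos (by positivity : 0 < 2 * Real.pi ^ 2),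
    e2, e1, abs_of_nonneg (by positivity : 0 ≤ (1 / (s ^ 2 + τ ^ 2)) ^ 2)]
  have h1 : τ / Real.pi ≤ τ := div_le_self hτ0 hpi
  -- As `s ≥ 1/2`, `s² + τ² ≥ 2sτ ≥ τ`; the numerator is thus absorbed by one of the two factors `s²
  -- + τ²` below.
  have h2 : τ ≤ 2 * (s ^ 2 + τ ^ 2) := by nlinarith [sq_nonneg (s - τ)]
  have h3 : 0 < s ^ 2 + τ ^ 2 := by positivity
  calc τ / Real.pi * (1 / (s ^ 2 + τ ^ 2)) ^ 2
      ≤ 2 * (s ^ 2 + τ ^ 2) * (1 / (s ^ 2 + τ ^ 2)) ^ 2 := by gcongr; linarith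
    _ = 2 * (1 / (s ^ 2 + τ ^ 2)) := by field_simp
    _ ≤ 2 * (1 / s ^ 2) := by
      gcongr
      linarith [sq_nonneg τ]

theorem phi_eq_tsum : phi = fun c => (2 * Real.pi ^ 2)⁻¹ * ∑' k, pgCoeff k c := by
  funext c
  rw [(hasSum_pgCoeff c).tsum_eq]
  field_simp

theorem hasDerivAt_phi (c : ℝ) : HasDerivAt phi
    ((2 * Real.pi ^ 2)⁻¹ * ∑' k, -(c / (2 * Real.pi ^ 2)) * pgCoeff k c ^ 2) c := by
  rw [phi_eq_tsum]
  exact (hasDerivAt_tsum (hasSum_inv_half_integer_sq.summable.mul_left 2) hasDerivAt_pgCoeff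
    abs_deriv_pgCoeff_le (hasSum_pgCoeff 0).summable c).const_mul _

theorem differentiable_phi : Differentiable ℝ phi := fun c => (hasDerivAt_phi c).differentiableAt

theorem abs_deriv_phi_le (c : ℝ) : |deriv phi c| ≤ 1 / 2 := by
  rw [(hasDerivAt_phi c).deriv, abs_mul, abs_of_pos (by positivity)]
  have h := tsum_of_norm_bounded (hasSum_inv_half_integer_sq.mul_left 2)
    (fun k => abs_deriv_pgCoeff_le k c)
  rw [Real.norm_eq_abs] at h
  calc _ ≤ (2 * Real.pi ^ 2)⁻¹ * (2 * (Real.pi ^ 2 / 2)) := by gcongr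
    _ = 1 / 2 := by field_simp

/-! ### The mean of the Pólya–Gamma law -/

theorem measurable_gammaPDF_one_one : Measurable (gammaPDF 1 1) :=
  (measurable_gammaPDFReal 1 1).ennreal_ofReal

theorem gammaMeasure_one_one_ae_nonneg : ∀ᵐ x ∂(gammaMeasure 1 1), 0 ≤ x := by
  rw [gammaMeasure, ae_withDensity_iff measurable_gammaPDF_one_one]
  filter_upwards with x hx
  by_contra h
  exact hx (gammaPDF_of_neg (not_le.1 h))

/-- Multiplying the `Gamma(1, 1)` density by `x` gives the `Gamma(2, 1)` density, whose total mass
is one. -/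
theorem lintegral_gammaMeasure_one_one : ∫⁻ x, ENNReal.ofReal x ∂(gammaMeasure 1 1) = 1 := by
  rw [gammaMeasure, lintegral_withDensity_eq_lintegral_mul _
    measurable_gammaPDF_one_one ENNReal.measurable_ofReal,
    ← lintegral_gammaPDF_eq_one (a := 2) (r := 1) two_pos one_pos]
  congr 1
  funext x
  rcases lt_or_ge x 0 with h | h
  · simp [gammaPDF_of_neg h]
  · rw [Pi.mul_apply, gammaPDF_of_nonneg h, gammaPDF_of_nonneg h, ← ENNReal.ofReal_mul]
    · congr 1
      rw [show (2 : ℝ) - 1 = 1 by norm_num, Real.rpow_one]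
      simp
      ring
    · simp
      positivity

theorem integrable_id_gammaMeasure_one_one : Integrable (fun x : ℝ => x) (gammaMeasure 1 1) := by
  refine ⟨measurable_id.aestronglyMeasurable, ?_⟩
  rw [hasFiniteIntegral_iff_ofReal gammaMeasure_one_one_ae_nonneg, lintegral_gammaMeasure_one_one]
  exact ENNReal.one_lt_top

theorem integral_id_gammaMeasure_one_one : ∫ x, x ∂(gammaMeasure 1 1) = 1 := by
  rw [integral_eq_lintegral_of_nonneg_ae gammaMeasure_one_one_ae_nonneg
    measurable_id.aestronglyMeasurable, lintegral_gammaMeasure_one_one, ENNReal.toReal_one]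

instance isProbabilityMeasure_gammaMeasure_one_one : IsProbabilityMeasure (gammaMeasure 1 1) :=
  isProbabilityMeasure_gammaMeasure one_pos one_pos

/-- The law of a sequence of independent `Gamma(1, 1)` variables. -/
noncomputable abbrev gammaSeq : Measure (ℕ → ℝ) :=
  Measure.infinitePi (fun _ : ℕ => gammaMeasure 1 1)

theorem integrable_eval_gammaSeq (k : ℕ) : Integrable (fun g : ℕ → ℝ => g k) gammaSeq :=
  (measurePreserving_eval_infinitePi (fun _ : ℕ => gammaMeasure 1 1) k).integrable_comp_of_integrable
    integrable_id_gammaMeasure_one_one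

theorem integral_eval_gammaSeq (k : ℕ) : ∫ g : ℕ → ℝ, g k ∂gammaSeq = 1 := by
  rw [← integral_id_gammaMeasure_one_one,
    ← (measurePreserving_eval_infinitePi (fun _ : ℕ => gammaMeasure 1 1) k).map_eq,
    integral_map (measurable_pi_apply k).aemeasurable (by fun_prop)]

theorem gammaSeq_ae_nonneg : ∀ᵐ g ∂gammaSeq, ∀ k, 0 ≤ g k := by
  rw [ae_all_iff]
  intro k
  exact (measurePreserving_eval_infinitePi (fun _ : ℕ => gammaMeasure 1 1) k).quasiMeasurePreserving.ae
    gammaMeasure_one_one_ae_nonneg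

theorem hasSum_integral_pg (c : ℝ) : HasSum (fun k => pgCoeff k c)
    (∫ g : ℕ → ℝ, ∑' k, g k * pgCoeff k c ∂gammaSeq) := by
  have hint : ∀ k, Integrable (fun g : ℕ → ℝ => g k * pgCoeff k c) gammaSeq :=
    fun k => (integrable_eval_gammaSeq k).mul_const _
  have hval : ∀ k, ∫ g : ℕ → ℝ, g k * pgCoeff k c ∂gammaSeq = pgCoeff k c := fun k => by
    rw [integral_mul_const, integral_eval_gammaSeq, one_mul]
  -- The Gamma variables are almost surely nonnegative, so the `L¹` norms equal the means; their
  -- summability justifies exchanging sum and integral.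
  have hnorm : ∀ k, ∫ g : ℕ → ℝ, ‖g k * pgCoeff k c‖ ∂gammaSeq = pgCoeff k c := fun k => by
    refine (integral_congr_ae ?_).trans (hval k)
    filter_upwards [gammaSeq_ae_nonneg] with g hg
    exact Real.norm_of_nonneg (mul_nonneg (hg k) (pgCoeff_pos k c).le)
  have := hasSum_integral_of_summable_integral_norm hint
    (by simp_rw [hnorm]; exact (hasSum_pgCoeff c).summable)
  simpa only [hval] using this

theorem measurable_pg_series (c : ℝ) :
    Measurable (fun g : ℕ → ℝ => 1 / (2 * Real.pi ^ 2) *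
      ∑' k : ℕ, g k / (((k : ℝ) + 1 / 2) ^ 2 + c ^ 2 / (4 * Real.pi ^ 2))) := by
  refine Measurable.const_mul ?_ _
  fun_prop

instance isProbabilityMeasure_polyaGamma (c : ℝ) : IsProbabilityMeasure (polyaGamma 1 c) :=
  Measure.isProbabilityMeasure_map (measurable_pg_series c).aemeasurable

theorem integral_polyaGamma (c : ℝ) : ∫ x, x ∂(polyaGamma 1 c) = phi c := by
  rw [polyaGamma, integral_map (f := fun x : ℝ => x) (measurable_pg_series c).aemeasurable
    measurable_id.aestronglyMeasurable, integral_const_mul]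
  have h := (hasSum_integral_pg c).unique (hasSum_pgCoeff c)
  have e : (fun g : ℕ → ℝ => ∑' k : ℕ, g k / (((k : ℝ) + 1 / 2) ^ 2 + c ^ 2 / (4 * Real.pi ^ 2))) =
      fun g => ∑' k, g k * pgCoeff k c := by
    funext g
    simp only [pgCoeff, mul_one_div]
  rw [e, h]
  field_simp

theorem precisionOf_muStar {n p : ℕ} (X : Matrix (Fin n) (Fin p) ℝ) (Q0 : Matrix (Fin p) (Fin p) ℝ)
    (ν : Measure (EuclideanSpace ℝ (Fin p))) :
    precisionOf X Q0 (muStar X ν) = precision X Q0 (fun i => phi (tilt X ν i)) := by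
  unfold precisionOf muStar
  congr 1
  funext i
  rw [← integral_polyaGamma]
  exact integral_comp_eval (μ := fun i => polyaGamma 1 (tilt X ν i)) (f := fun x : ℝ => x)
    measurable_id.aestronglyMeasurable

/-! ### Second moments and affine images of Gaussian measures -/

theorem dotProduct_eq_inner {p : ℕ} (v : Fin p → ℝ) (z : EuclideanSpace ℝ (Fin p)) :
    v ⬝ᵥ z.ofLp = inner ℝ (WithLp.toLp 2 v) z := by
  rw [EuclideanSpace.inner_eq_star_dotProduct, dotProduct_comm]
  simp

theorem memLp_dotProduct_stdGaussian {p : ℕ} (v : Fin p → ℝ) :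
    MemLp (fun z : EuclideanSpace ℝ (Fin p) => v ⬝ᵥ z.ofLp) 2
      (stdGaussian (EuclideanSpace ℝ (Fin p))) := by
  simp_rw [dotProduct_eq_inner]
  exact IsGaussian.memLp_dual _ (innerSL ℝ (WithLp.toLp 2 v)) 2 (by simp)

theorem integrable_sq_affine_stdGaussian {p : ℕ} (a : ℝ) (v : Fin p → ℝ) :
    Integrable (fun z : EuclideanSpace ℝ (Fin p) => (a + v ⬝ᵥ z.ofLp) ^ 2)
      (stdGaussian (EuclideanSpace ℝ (Fin p))) :=
  ((memLp_const a).add (memLp_dotProduct_stdGaussian v)).integrable_sq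

theorem integral_sq_affine_stdGaussian {p : ℕ} (a : ℝ) (v : Fin p → ℝ) :
    ∫ z : EuclideanSpace ℝ (Fin p), (a + v ⬝ᵥ z.ofLp) ^ 2
      ∂(stdGaussian (EuclideanSpace ℝ (Fin p))) = a ^ 2 + v ⬝ᵥ v := by
  have hv := memLp_dotProduct_stdGaussian v
  have h1 : ∫ z : EuclideanSpace ℝ (Fin p), v ⬝ᵥ z.ofLp
      ∂(stdGaussian (EuclideanSpace ℝ (Fin p))) = 0 := by
    simp_rw [dotProduct_eq_inner]
    exact integral_strongDual_stdGaussian (innerSL ℝ (WithLp.toLp 2 v))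
  have h2 : ∫ z : EuclideanSpace ℝ (Fin p), (v ⬝ᵥ z.ofLp) ^ 2
      ∂(stdGaussian (EuclideanSpace ℝ (Fin p))) = v ⬝ᵥ v := by
    have h := variance_dual_stdGaussian (innerSL ℝ (WithLp.toLp 2 v))
    rw [variance_of_integral_eq_zero (by fun_prop) (integral_strongDual_stdGaussian _)] at h
    simp_rw [dotProduct_eq_inner]
    rw [innerSL_apply_norm, ← real_inner_self_eq_norm_sq] at h
    exact h
  have e : (fun z : EuclideanSpace ℝ (Fin p) => (a + v ⬝ᵥ z.ofLp) ^ 2) =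
      fun z => (a ^ 2 + 2 * a * (v ⬝ᵥ z.ofLp)) + (v ⬝ᵥ z.ofLp) ^ 2 := by
    funext z
    ring
  have hi := hv.integrable (by norm_num)
  have hi' : Integrable (fun z : EuclideanSpace ℝ (Fin p) => a ^ 2 + 2 * a * (v ⬝ᵥ z.ofLp))
      (stdGaussian (EuclideanSpace ℝ (Fin p))) := (integrable_const _).add (hi.const_mul _)
  rw [e, integral_add hi' hv.integrable_sq,
    integral_add (integrable_const _) (hi.const_mul _), integral_const_mul, h1, h2]
  simp

theorem dotProduct_self_affine {p : ℕ} (b : Fin p → ℝ) (K : Matrix (Fin p) (Fin p) ℝ)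
    (z : Fin p → ℝ) : (b + K *ᵥ z) ⬝ᵥ (b + K *ᵥ z) = ∑ j, (b j + K.row j ⬝ᵥ z) ^ 2 := by
  simp only [dotProduct, Pi.add_apply, mulVec, sq, row]

theorem integrable_dotProduct_self_affine_stdGaussian {p : ℕ} (b : Fin p → ℝ)
    (K : Matrix (Fin p) (Fin p) ℝ) :
    Integrable (fun z : EuclideanSpace ℝ (Fin p) => (b + K *ᵥ z.ofLp) ⬝ᵥ (b + K *ᵥ z.ofLp))
      (stdGaussian (EuclideanSpace ℝ (Fin p))) := by
  simp_rw [dotProduct_self_affine]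
  exact integrable_finsetSum _ fun j _ => integrable_sq_affine_stdGaussian _ _

theorem integral_dotProduct_self_affine_stdGaussian {p : ℕ} (b : Fin p → ℝ)
    (K : Matrix (Fin p) (Fin p) ℝ) :
    ∫ z : EuclideanSpace ℝ (Fin p), (b + K *ᵥ z.ofLp) ⬝ᵥ (b + K *ᵥ z.ofLp)
      ∂(stdGaussian (EuclideanSpace ℝ (Fin p))) = b ⬝ᵥ b + (K * Kᵀ).trace := by
  simp_rw [dotProduct_self_affine]
  rw [integral_finsetSum _ fun j _ => integrable_sq_affine_stdGaussian _ _]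
  simp_rw [integral_sq_affine_stdGaussian, Finset.sum_add_distrib]
  congr 1
  simp only [dotProduct, sq]

/-- An affine image of the standard Gaussian measure is Gaussian. -/
theorem stdGaussian_map_affine {p : ℕ} (b : EuclideanSpace ℝ (Fin p))
    (L S : Matrix (Fin p) (Fin p) ℝ) (hS : L * Lᵀ = S) :
    (stdGaussian (EuclideanSpace ℝ (Fin p))).map
      (fun z => b + toEuclideanCLM (𝕜 := ℝ) L z) = multivariateGaussian b S := by
  have hpos : S.PosSemidef := by
    rw [← hS, ← conjTranspose_eq_transpose_of_trivial]
    exact posSemidef_self_mul_conjTranspose L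
  apply Measure.ext_of_charFun
  ext t
  rw [charFun_multivariateGaussian hpos, charFun_apply, integral_map (by fun_prop) (by fun_prop)]
  -- Moving `L` onto `t` by its adjoint turns the integral into the standard characteristic function
  -- at `Lᵀ t`, and `|Lᵀ t|² = tᵀ S t`.
  have e : ∀ z : EuclideanSpace ℝ (Fin p),
      Complex.exp (((inner ℝ (b + toEuclideanCLM (𝕜 := ℝ) L z) t : ℝ) : ℂ) * Complex.I) =
      Complex.exp (((inner ℝ t b : ℝ) : ℂ) * Complex.I) * Complex.exp (((inner ℝ z
        (ContinuousLinearMap.adjoint (toEuclideanCLM (𝕜 := ℝ) L) t) : ℝ) : ℂ) * Complex.I) := by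
    intro z
    rw [← Complex.exp_add, inner_add_left, ContinuousLinearMap.adjoint_inner_right,
      real_inner_comm t b]
    push_cast
    ring_nf
  simp_rw [e]
  rw [integral_const_mul, ← charFun_apply, charFun_stdGaussian, ← Complex.exp_add]
  congr 1
  rw [← Complex.ofReal_pow, ← real_inner_self_eq_norm_sq, ContinuousLinearMap.adjoint_inner_left,
    ← ContinuousLinearMap.star_eq_adjoint, ← map_star, ← mul_apply_eq_comp,
    ← map_mul, inner_toEuclideanCLM, star_eq_conjTranspose, conjTranspose_eq_transpose_of_trivial,
    hS]
  ring

theorem sqrt_mul_transpose_sqrt {p : ℕ} {S : Matrix (Fin p) (Fin p) ℝ} (hS : S.PosSemidef) :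
    CFC.sqrt S * (CFC.sqrt S)ᵀ = S := by
  have h : (CFC.sqrt S)ᵀ = CFC.sqrt S := by
    have := (CFC.sqrt_nonneg S).isSelfAdjoint.star_eq
    rwa [star_eq_conjTranspose, conjTranspose_eq_transpose_of_trivial] at this
  rw [h, CFC.sqrt_mul_sqrt_self _ hS.nonneg]

theorem integral_dotProduct_sq_multivariateGaussian {p : ℕ} (b : EuclideanSpace ℝ (Fin p))
    {S : Matrix (Fin p) (Fin p) ℝ} (hS : S.PosSemidef) (x : Fin p → ℝ) :
    ∫ β, (x ⬝ᵥ β.ofLp) ^ 2 ∂(multivariateGaussian b S) = x ⬝ᵥ (S *ᵥ x) + (x ⬝ᵥ b.ofLp) ^ 2 := by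
  rw [multivariateGaussian, integral_map (by fun_prop) (by fun_prop)]
  have e : ∀ z : EuclideanSpace ℝ (Fin p),
      x ⬝ᵥ (b + toEuclideanCLM (𝕜 := ℝ) (CFC.sqrt S) z).ofLp =
        x ⬝ᵥ b.ofLp + (x ᵥ* CFC.sqrt S) ⬝ᵥ z.ofLp := by
    intro z
    rw [WithLp.ofLp_add, dotProduct_add, ofLp_toEuclideanCLM, dotProduct_mulVec]
  simp_rw [e, integral_sq_affine_stdGaussian]
  nth_rw 3 [← sqrt_mul_transpose_sqrt hS]
  rw [← mulVec_mulVec, dotProduct_mulVec, mulVec_transpose]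
  ring

theorem memLp_dotProduct_multivariateGaussian {p : ℕ} (b : EuclideanSpace ℝ (Fin p))
    (S : Matrix (Fin p) (Fin p) ℝ) (x : Fin p → ℝ) :
    MemLp (fun β : EuclideanSpace ℝ (Fin p) => x ⬝ᵥ β.ofLp) 2 (multivariateGaussian b S) := by
  simp_rw [dotProduct_eq_inner]
  exact IsGaussian.memLp_dual _ (innerSL ℝ (WithLp.toLp 2 x)) 2 (by simp)

/-! ### Positive definite matrices and the Gaussian transport-information inequality -/

variable {n p : ℕ}

theorem _root_.Matrix.PosDef.transpose_eq {A : Matrix (Fin p) (Fin p) ℝ} (hA : A.PosDef) :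
    Aᵀ = A := by
  rw [← conjTranspose_eq_transpose_of_trivial]
  exact hA.isHermitian

theorem _root_.Matrix.PosDef.mul_inv_self {A : Matrix (Fin p) (Fin p) ℝ} (hA : A.PosDef) :
    A * A⁻¹ = 1 :=
  mul_nonsing_inv A ((isUnit_iff_isUnit_det A).1 hA.isUnit)

theorem _root_.Matrix.PosDef.inv_mul_self {A : Matrix (Fin p) (Fin p) ℝ} (hA : A.PosDef) :
    A⁻¹ * A = 1 :=
  nonsing_inv_mul A ((isUnit_iff_isUnit_det A).1 hA.isUnit)

theorem _root_.Matrix.PosDef.cfcSqrt {A : Matrix (Fin p) (Fin p) ℝ} (hA : A.PosDef) :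
    (CFC.sqrt A).PosDef :=
  (hA.isStrictlyPositive.sqrt).posDef

theorem _root_.Matrix.PosDef.cfcSqrt_mul_self {A : Matrix (Fin p) (Fin p) ℝ} (hA : A.PosDef) :
    CFC.sqrt A * CFC.sqrt A = A :=
  CFC.sqrt_mul_sqrt_self _ hA.posSemidef.nonneg

/-- Squared lengths in the geometry `B = T * T`, for a symmetric `T`. -/
theorem dotProduct_mulVec_mul_self {T B : Matrix (Fin p) (Fin p) ℝ} (hT : Tᵀ = T) (hB : T * T = B)
    (v : Fin p → ℝ) : v ⬝ᵥ (B *ᵥ v) = (T *ᵥ v) ⬝ᵥ (T *ᵥ v) := by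
  rw [← hB, ← mulVec_mulVec, dotProduct_mulVec, ← mulVec_transpose, hT]

theorem sqNormOf_nonneg {B : Matrix (Fin p) (Fin p) ℝ} (hB : B.PosSemidef)
    (v : EuclideanSpace ℝ (Fin p)) : 0 ≤ sqNormOf B v := by
  simpa [sqNormOf] using hB.dotProduct_mulVec_nonneg v.ofLp

theorem wasserstein2_sq (B : Matrix (Fin p) (Fin p) ℝ)
    (ν ρ : Measure (EuclideanSpace ℝ (Fin p))) :
    wasserstein2 B ν ρ ^ 2 =
      ⨅ γ ∈ couplings ν ρ, ∫⁻ z, ENNReal.ofReal (sqNormOf B (z.1 - z.2)) ∂γ := by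
  rw [wasserstein2, ← ENNReal.rpow_natCast, ← ENNReal.rpow_mul]
  norm_num

theorem measurable_sqNormOf (B : Matrix (Fin p) (Fin p) ℝ) : Measurable (sqNormOf B) := by
  unfold sqNormOf
  refine Continuous.measurable ?_
  fun_prop

/-- `tr (R⁻¹ - 1)² ≤ tr (R - R⁻¹)²` for a positive definite matrix `R`. -/
theorem trace_sq_inv_sub_one_le {R : Matrix (Fin p) (Fin p) ℝ} (hR : R.PosDef) :
    ((R⁻¹ - 1) * (R⁻¹ - 1)ᵀ).trace ≤ ((R - R⁻¹) * (R - R⁻¹)ᵀ).trace := by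
  have h1 := hR.mul_inv_self
  have h2 := hR.inv_mul_self
  have hsub : (R - 1)ᴴ = R - 1 := by
    rw [conjTranspose_eq_transpose_of_trivial, transpose_sub, hR.transpose_eq, transpose_one]
  -- Matrix form of the scalar identity `(r - 1/r)² - (1/r - 1)² = (r - 1)² (1 + 2/r)`, whose right
  -- side is nonnegative for `r > 0`.
  have hp : ((R - 1) * (1 + (R⁻¹ + R⁻¹)) * (R - 1)ᴴ).PosSemidef :=
    (PosSemidef.one.add (hR.inv.posSemidef.add hR.inv.posSemidef)).mul_mul_conjTranspose_same _
  have h := hp.trace_nonneg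
  have e : (R - 1) * (1 + (R⁻¹ + R⁻¹)) * (R - 1)ᴴ =
      (R - R⁻¹) * (R - R⁻¹) - (R⁻¹ - 1) * (R⁻¹ - 1) := by
    rw [hsub]
    simp only [mul_add, add_mul, mul_sub, sub_mul, mul_one, one_mul, h1, h2]
    abel
  rw [e, trace_sub] at h
  rw [transpose_sub, transpose_sub, transpose_one, hR.transpose_eq, hR.inv.transpose_eq]
  linarith

/-- A Gaussian transport-information inequality: the distance between two Gaussian measures with
precisions `Qc`, `Qs` and means `Qc⁻¹ m`, `Qs⁻¹ m` is at most the relative Fisher information. -/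
theorem wasserstein2_sq_gaussian_le {Qs Qc : Matrix (Fin p) (Fin p) ℝ} (hs : Qs.PosDef)
    (hc : Qc.PosDef) (m : Fin p → ℝ) :
    wasserstein2 Qs (multivariateGaussian (WithLp.toLp 2 (Qc⁻¹ *ᵥ m)) Qc⁻¹)
        (multivariateGaussian (WithLp.toLp 2 (Qs⁻¹ *ᵥ m)) Qs⁻¹) ^ 2 ≤
      ENNReal.ofReal (∫ β, ((Qc - Qs) *ᵥ β.ofLp) ⬝ᵥ (Qs⁻¹ *ᵥ ((Qc - Qs) *ᵥ β.ofLp))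
        ∂(multivariateGaussian (WithLp.toLp 2 (Qc⁻¹ *ᵥ m)) Qc⁻¹)) := by
  set P := CFC.sqrt Qs⁻¹ with hP
  have pP : P.PosDef := hs.inv.cfcSqrt
  have PP : P * P = Qs⁻¹ := hs.inv.cfcSqrt_mul_self
  have tP : Pᵀ = P := pP.transpose_eq
  have P1 : P * P⁻¹ = 1 := pP.mul_inv_self
  have P2 : P⁻¹ * P = 1 := pP.inv_mul_self
  have tPi : P⁻¹ᵀ = P⁻¹ := pP.inv.transpose_eq
  have PiPi : P⁻¹ * P⁻¹ = Qs := by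
    rw [← Matrix.mul_inv_rev, PP, nonsing_inv_nonsing_inv _
      ((isUnit_iff_isUnit_det Qs).1 hs.isUnit)]
  have pPQP : (P * Qc * P).PosDef := by
    have := hc.mul_mul_conjTranspose_same (B := P)
      (vecMul_injective_of_isUnit pP.isUnit)
    rwa [conjTranspose_eq_transpose_of_trivial, tP] at this
  -- `P * R⁻¹` is a square root of `Qc⁻¹` and `P` one of `Qs⁻¹`, so a single standard Gaussian `z`
  -- drives both measures. In the coordinates `P⁻¹ β` the coupled points differ by `d + (R⁻¹ - 1)
  -- z`.
  set R := CFC.sqrt (P * Qc * P) with hR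
  have pR : R.PosDef := pPQP.cfcSqrt
  have RR : R * R = P * Qc * P := pPQP.cfcSqrt_mul_self
  have R1 : R * R⁻¹ = 1 := pR.mul_inv_self
  have tRi : R⁻¹ᵀ = R⁻¹ := pR.inv.transpose_eq
  have hLc : P * R⁻¹ * (P * R⁻¹)ᵀ = Qc⁻¹ := by
    rw [transpose_mul, tP, tRi]
    symm
    apply inv_eq_left_inv
    calc P * R⁻¹ * (R⁻¹ * P) * Qc = P * (R⁻¹ * R⁻¹) * (P * Qc * P) * P⁻¹ := by
          simp only [mul_assoc, P1, mul_one]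
      _ = P * (R⁻¹ * (R⁻¹ * R) * R) * P⁻¹ := by rw [← RR]; simp only [mul_assoc]
      _ = 1 := by rw [pR.inv_mul_self, mul_one, pR.inv_mul_self, mul_one, P1]
  have hLs : P * Pᵀ = Qs⁻¹ := by rw [tP, PP]
  have mapc := stdGaussian_map_affine (WithLp.toLp 2 (Qc⁻¹ *ᵥ m)) _ _ hLc
  have maps := stdGaussian_map_affine (WithLp.toLp 2 (Qs⁻¹ *ᵥ m)) _ _ hLs
  set d : Fin p → ℝ := P⁻¹ *ᵥ (Qc⁻¹ *ᵥ m - Qs⁻¹ *ᵥ m) with hd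
  have cost : ∀ z : EuclideanSpace ℝ (Fin p),
      sqNormOf Qs ((WithLp.toLp 2 (Qc⁻¹ *ᵥ m) + toEuclideanCLM (𝕜 := ℝ) (P * R⁻¹) z) -
        (WithLp.toLp 2 (Qs⁻¹ *ᵥ m) + toEuclideanCLM (𝕜 := ℝ) P z)) =
      (d + (R⁻¹ - 1) *ᵥ z.ofLp) ⬝ᵥ (d + (R⁻¹ - 1) *ᵥ z.ofLp) := by
    intro z
    rw [sqNormOf, dotProduct_mulVec_mul_self tPi PiPi]
    have : P⁻¹ *ᵥ ((WithLp.toLp 2 (Qc⁻¹ *ᵥ m) + toEuclideanCLM (𝕜 := ℝ) (P * R⁻¹) z) -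
        (WithLp.toLp 2 (Qs⁻¹ *ᵥ m) + toEuclideanCLM (𝕜 := ℝ) P z)).ofLp =
        d + (R⁻¹ - 1) *ᵥ z.ofLp := by
      simp only [WithLp.ofLp_sub, WithLp.ofLp_add, ofLp_toEuclideanCLM, hd, mulVec_sub,
        mulVec_add, mulVec_mulVec, sub_mulVec, ← mul_assoc, P2, one_mul]
      abel
    rw [this]
  -- In the same variables the score difference is `-d + (R - R⁻¹) z`. The mean parts have equal
  -- length, so only the two traces remain to be compared.
  have info : ∀ z : EuclideanSpace ℝ (Fin p),
      ((Qc - Qs) *ᵥ (WithLp.toLp 2 (Qc⁻¹ *ᵥ m) + toEuclideanCLM (𝕜 := ℝ) (P * R⁻¹) z).ofLp) ⬝ᵥ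
        (Qs⁻¹ *ᵥ ((Qc - Qs) *ᵥ
          (WithLp.toLp 2 (Qc⁻¹ *ᵥ m) + toEuclideanCLM (𝕜 := ℝ) (P * R⁻¹) z).ofLp)) =
      (-d + (R - R⁻¹) *ᵥ z.ofLp) ⬝ᵥ (-d + (R - R⁻¹) *ᵥ z.ofLp) := by
    intro z
    rw [dotProduct_mulVec_mul_self tP PP]
    have e1 : ∀ Y, P * (Qs * Y) = P⁻¹ * Y := fun Y => by
      rw [← PiPi, ← mul_assoc, ← mul_assoc, P1, one_mul]
    have e2 : P * (Qc * (P * R⁻¹)) = R := by rw [← mul_assoc, ← mul_assoc, ← RR, mul_assoc, R1, mul_one]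
    have e3 : P⁻¹ * Qs⁻¹ = P := by rw [← PP, ← mul_assoc, P2, one_mul]
    have e4 : P⁻¹ * (P * R⁻¹) = R⁻¹ := by rw [← mul_assoc, P2, one_mul]
    have : P *ᵥ ((Qc - Qs) *ᵥ
        (WithLp.toLp 2 (Qc⁻¹ *ᵥ m) + toEuclideanCLM (𝕜 := ℝ) (P * R⁻¹) z).ofLp) =
        -d + (R - R⁻¹) *ᵥ z.ofLp := by
      simp only [WithLp.ofLp_add, ofLp_toEuclideanCLM, hd, mulVec_sub, mulVec_add, mulVec_mulVec,
        sub_mulVec, sub_mul, e1, e2, e3, e4, hc.mul_inv_self, mul_one]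
      abel
    rw [this]
  rw [← mapc, integral_map (by fun_prop) (by
    refine Continuous.aestronglyMeasurable ?_
    fun_prop)]
  simp_rw [info]
  rw [integral_dotProduct_self_affine_stdGaussian, wasserstein2_sq]
  refine (iInf₂_le ((stdGaussian (EuclideanSpace ℝ (Fin p))).map
    (fun z => (WithLp.toLp 2 (Qc⁻¹ *ᵥ m) + toEuclideanCLM (𝕜 := ℝ) (P * R⁻¹) z,
      WithLp.toLp 2 (Qs⁻¹ *ᵥ m) + toEuclideanCLM (𝕜 := ℝ) P z))) ⟨?_, ?_⟩).trans ?_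
  · have hm : Measurable fun z : EuclideanSpace ℝ (Fin p) × EuclideanSpace ℝ (Fin p) =>
        ENNReal.ofReal (sqNormOf Qs (z.1 - z.2)) :=
      ((measurable_sqNormOf Qs).comp (measurable_fst.sub measurable_snd)).ennreal_ofReal
    rw [lintegral_map hm (by fun_prop)]
    simp_rw [cost]
    rw [← ofReal_integral_eq_lintegral_ofReal (integrable_dotProduct_self_affine_stdGaussian _ _)
      (.of_forall fun z => Finset.sum_nonneg fun j _ => mul_self_nonneg _),
      integral_dotProduct_self_affine_stdGaussian]
    apply ENNReal.ofReal_le_ofReal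
    rw [neg_dotProduct_neg]
    gcongr
    exact trace_sq_inv_sub_one_le pR
  · rw [Measure.fst_map_prodMk (by fun_prop)]
  · rw [Measure.snd_map_prodMk (by fun_prop), maps]

/-! ### Bounds for `Q(c)` and `S(c)`, and the one-step estimate in terms of tilts -/

theorem dotProduct_conj_diagonal (X : Matrix (Fin n) (Fin p) ℝ) (w : Fin n → ℝ) (v : Fin p → ℝ) :
    v ⬝ᵥ ((Xᵀ * diagonal w * X) *ᵥ v) = ∑ i, w i * (X i ⬝ᵥ v) ^ 2 := by
  rw [← mulVec_mulVec, ← mulVec_mulVec, dotProduct_mulVec, vecMul_transpose]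
  simp only [dotProduct, mulVec_diagonal]
  refine Finset.sum_congr rfl fun i _ => ?_
  change (∑ j, X i j * v j) * (w i * ∑ j, X i j * v j) = _
  ring

theorem dotProduct_precision (X : Matrix (Fin n) (Fin p) ℝ) (Q0 : Matrix (Fin p) (Fin p) ℝ)
    (w : Fin n → ℝ) (v : Fin p → ℝ) :
    v ⬝ᵥ (precision X Q0 w *ᵥ v) = ∑ i, w i * (X i ⬝ᵥ v) ^ 2 + v ⬝ᵥ (Q0 *ᵥ v) := by
  rw [precision, add_mulVec, dotProduct_add, dotProduct_conj_diagonal]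

theorem precision_posDef (X : Matrix (Fin n) (Fin p) ℝ) {Q0 : Matrix (Fin p) (Fin p) ℝ}
    (hQ0 : Q0.PosDef) {w : Fin n → ℝ} (hw : ∀ i, 0 ≤ w i) : (precision X Q0 w).PosDef := by
  have h := (PosSemidef.diagonal (show (0 : Fin n → ℝ) ≤ w from hw)).conjTranspose_mul_mul_same X
  rw [conjTranspose_eq_transpose_of_trivial] at h
  exact PosDef.posSemidef_add h hQ0

theorem precision_sub_mulVec (X : Matrix (Fin n) (Fin p) ℝ) (Q0 : Matrix (Fin p) (Fin p) ℝ)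
    (w w' : Fin n → ℝ) (v : Fin p → ℝ) :
    (precision X Q0 w - precision X Q0 w') *ᵥ v = Xᵀ *ᵥ fun i => (w i - w' i) * (X i ⬝ᵥ v) := by
  rw [precision, precision, add_sub_add_right_eq_sub, ← Matrix.sub_mul, ← Matrix.mul_sub, diagonal_sub,
    ← mulVec_mulVec, ← mulVec_mulVec]
  congr 1
  funext i
  rw [mulVec_diagonal]
  rfl

/-- The Cauchy–Schwarz inequality for the duality between `B` and `B⁻¹`. -/
theorem dotProduct_sq_le_of_posDef {B : Matrix (Fin p) (Fin p) ℝ} (hB : B.PosDef)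
    (u v : Fin p → ℝ) : (u ⬝ᵥ v) ^ 2 ≤ (u ⬝ᵥ (B⁻¹ *ᵥ u)) * (v ⬝ᵥ (B *ᵥ v)) := by
  set T := CFC.sqrt B
  have pT : T.PosDef := hB.cfcSqrt
  have TT : T * T = B := hB.cfcSqrt_mul_self
  have e : u ⬝ᵥ v = (T⁻¹ *ᵥ u) ⬝ᵥ (T *ᵥ v) := by
    rw [dotProduct_mulVec, ← mulVec_transpose, pT.transpose_eq, mulVec_mulVec, pT.mul_inv_self,
      one_mulVec]
  rw [e, dotProduct_mulVec_mul_self pT.transpose_eq TT,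
    dotProduct_mulVec_mul_self pT.inv.transpose_eq (by rw [← Matrix.mul_inv_rev, TT])]
  have := Finset.sum_mul_sq_le_sq_mul_sq Finset.univ (T⁻¹ *ᵥ u) (T *ᵥ v)
  simpa only [dotProduct, sq] using this

theorem dotProduct_mulVec_nonneg_of_posDef {B : Matrix (Fin p) (Fin p) ℝ} (hB : B.PosDef)
    (v : Fin p → ℝ) : 0 ≤ v ⬝ᵥ (B *ᵥ v) := by
  simpa using hB.posSemidef.dotProduct_mulVec_nonneg v

theorem dotProduct_inv_self {B : Matrix (Fin p) (Fin p) ℝ} (hB : B.PosDef) (u : Fin p → ℝ) :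
    (B⁻¹ *ᵥ u) ⬝ᵥ (B *ᵥ (B⁻¹ *ᵥ u)) = u ⬝ᵥ (B⁻¹ *ᵥ u) := by
  rw [mulVec_mulVec, hB.mul_inv_self, one_mulVec, dotProduct_comm]

/-- The dual form of `Xᵀ diag(w) X ≤ Xᵀ diag(w) X + Q₀`. -/
theorem dotProduct_precision_inv_le (X : Matrix (Fin n) (Fin p) ℝ)
    {Q0 : Matrix (Fin p) (Fin p) ℝ} (hQ0 : Q0.PosDef) {w : Fin n → ℝ} (hw : ∀ i, 0 < w i)
    (u : Fin n → ℝ) :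
    (Xᵀ *ᵥ u) ⬝ᵥ ((precision X Q0 w)⁻¹ *ᵥ (Xᵀ *ᵥ u)) ≤ ∑ i, u i ^ 2 / w i := by
  have hp := precision_posDef X hQ0 (fun i => (hw i).le)
  set v := (precision X Q0 w)⁻¹ *ᵥ (Xᵀ *ᵥ u) with hv
  -- The left side `q` is computed twice: linearly in `u`, and as a quadratic form in `v`. Young's
  -- inequality termwise then gives `2q ≤ q + ∑ u_i² / w_i`.
  have e1 : (Xᵀ *ᵥ u) ⬝ᵥ v = ∑ i, u i * (X i ⬝ᵥ v) := by
    rw [mulVec_transpose, ← dotProduct_mulVec]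
    rfl
  have e2 : (Xᵀ *ᵥ u) ⬝ᵥ v = ∑ i, w i * (X i ⬝ᵥ v) ^ 2 + v ⬝ᵥ (Q0 *ᵥ v) := by
    rw [← dotProduct_precision, hv, dotProduct_inv_self hp]
  have h0 := dotProduct_mulVec_nonneg_of_posDef hQ0 v
  have h1 : ∑ i, 2 * (u i * (X i ⬝ᵥ v)) ≤ ∑ i, (w i * (X i ⬝ᵥ v) ^ 2 + u i ^ 2 / w i) := by
    refine Finset.sum_le_sum fun i _ => ?_
    have hi := hw i
    have e : w i * (X i ⬝ᵥ v) ^ 2 + u i ^ 2 / w i - 2 * (u i * (X i ⬝ᵥ v)) =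
        (w i * (X i ⬝ᵥ v) - u i) ^ 2 / w i := by
      field_simp
      ring
    have : 0 ≤ (w i * (X i ⬝ᵥ v) - u i) ^ 2 / w i := by positivity
    linarith
  rw [← Finset.mul_sum, Finset.sum_add_distrib] at h1
  linarith

/-- Cauchy–Schwarz for `A`, applied to `u` and `B⁻¹ u`, gives `q² ≤ (uᵀ A⁻¹ u) q` with `q = uᵀ B⁻¹
u`; it remains to cancel `q`. -/
theorem dotProduct_inv_anti {A B : Matrix (Fin p) (Fin p) ℝ} (hA : A.PosDef) (hB : B.PosDef)
    (hAB : ∀ v, v ⬝ᵥ (A *ᵥ v) ≤ v ⬝ᵥ (B *ᵥ v)) (u : Fin p → ℝ) :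
    u ⬝ᵥ (B⁻¹ *ᵥ u) ≤ u ⬝ᵥ (A⁻¹ *ᵥ u) := by
  have h1 := dotProduct_sq_le_of_posDef hA u (B⁻¹ *ᵥ u)
  have h2 := hAB (B⁻¹ *ᵥ u)
  rw [dotProduct_inv_self hB] at h2
  have h3 := dotProduct_mulVec_nonneg_of_posDef hA.inv u
  have h4 := dotProduct_mulVec_nonneg_of_posDef hB.inv u
  rcases h4.eq_or_lt with h | h
  · rw [← h]
    exact h3
  · have : (u ⬝ᵥ (B⁻¹ *ᵥ u)) ^ 2 ≤ (u ⬝ᵥ (A⁻¹ *ᵥ u)) * (u ⬝ᵥ (B⁻¹ *ᵥ u)) :=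
      h1.trans (mul_le_mul_of_nonneg_left h2 h3)
    rw [sq] at this
    exact le_of_mul_le_mul_right this h

theorem dotProduct_secondMoment (X : Matrix (Fin n) (Fin p) ℝ) (y : Fin n → ℝ) (m0 : Fin p → ℝ)
    (Q0 : Matrix (Fin p) (Fin p) ℝ) (c : Fin n → ℝ) (x : Fin p → ℝ) :
    x ⬝ᵥ (secondMoment X y m0 Q0 c *ᵥ x) =
      x ⬝ᵥ ((precision X Q0 (fun i => phi (c i)))⁻¹ *ᵥ x) +
        (x ⬝ᵥ ((precision X Q0 (fun i => phi (c i)))⁻¹ *ᵥ shift X y m0 Q0)) ^ 2 := by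
  rw [secondMoment, add_mulVec, dotProduct_add, vecMulVec_mulVec, op_smul_eq_smul, dotProduct_smul,
    smul_eq_mul, sq, dotProduct_comm _ x]

/-- The bound is uniform in `c` because `Q(c) ≥ Q₀`. For the mean part, Cauchy–Schwarz in `Q₀`
leaves `m(c)ᵀ Q₀ m(c) ≤ m(c)ᵀ Q(c) m(c) = mᵀ Q(c)⁻¹ m ≤ mᵀ Q₀⁻¹ m`. -/
theorem exists_dotProduct_secondMoment_le (X : Matrix (Fin n) (Fin p) ℝ) (y : Fin n → ℝ)
    (m0 : Fin p → ℝ) {Q0 : Matrix (Fin p) (Fin p) ℝ} (hQ0 : Q0.PosDef) (x : Fin p → ℝ) :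
    ∃ K, ∀ c, x ⬝ᵥ (secondMoment X y m0 Q0 c *ᵥ x) ≤ K := by
  refine ⟨x ⬝ᵥ (Q0⁻¹ *ᵥ x) +
    (x ⬝ᵥ (Q0⁻¹ *ᵥ x)) * (shift X y m0 Q0 ⬝ᵥ (Q0⁻¹ *ᵥ shift X y m0 Q0)), fun c => ?_⟩
  have hp := precision_posDef X hQ0 (fun i => (phi_pos (c i)).le)
  have hle : ∀ v, v ⬝ᵥ (Q0 *ᵥ v) ≤ v ⬝ᵥ (precision X Q0 (fun i => phi (c i)) *ᵥ v) := fun v => by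
    rw [dotProduct_precision]
    have : 0 ≤ ∑ i, phi (c i) * (X i ⬝ᵥ v) ^ 2 :=
      Finset.sum_nonneg fun i _ => mul_nonneg (phi_pos _).le (sq_nonneg _)
    linarith
  rw [dotProduct_secondMoment]
  have h1 := dotProduct_inv_anti hQ0 hp hle
  have h2 := dotProduct_sq_le_of_posDef hQ0 x
    ((precision X Q0 (fun i => phi (c i)))⁻¹ *ᵥ shift X y m0 Q0)
  have h3 := hle ((precision X Q0 (fun i => phi (c i)))⁻¹ *ᵥ shift X y m0 Q0)
  rw [dotProduct_inv_self hp] at h3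
  have h4 := dotProduct_mulVec_nonneg_of_posDef hQ0.inv x
  exact add_le_add (h1 x) (h2.trans (mul_le_mul_of_nonneg_left (h3.trans (h1 _)) h4))

theorem dotProduct_secondMoment_nonneg (X : Matrix (Fin n) (Fin p) ℝ) (y : Fin n → ℝ)
    (m0 : Fin p → ℝ) {Q0 : Matrix (Fin p) (Fin p) ℝ} (hQ0 : Q0.PosDef) (c : Fin n → ℝ)
    (x : Fin p → ℝ) : 0 ≤ x ⬝ᵥ (secondMoment X y m0 Q0 c *ᵥ x) := by
  rw [dotProduct_secondMoment]
  exact add_nonneg (dotProduct_mulVec_nonneg_of_posDef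
    (precision_posDef X hQ0 (fun i => (phi_pos (c i)).le)).inv x) (sq_nonneg _)

/-- The Gaussian `N(Q(c)⁻¹ m, Q(c)⁻¹)`. -/
noncomputable def gaussianOf (X : Matrix (Fin n) (Fin p) ℝ) (y : Fin n → ℝ) (m0 : Fin p → ℝ)
    (Q0 : Matrix (Fin p) (Fin p) ℝ) (c : Fin n → ℝ) : Measure (EuclideanSpace ℝ (Fin p)) :=
  multivariateGaussian
    (WithLp.toLp 2 ((precision X Q0 (fun i => phi (c i)))⁻¹ *ᵥ shift X y m0 Q0))
    (precision X Q0 (fun i => phi (c i)))⁻¹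

/-- From here on the Pólya–Gamma factor is eliminated: the update is a function of the tilt vector
alone. -/
theorem nuStar_muStar (X : Matrix (Fin n) (Fin p) ℝ) (y : Fin n → ℝ) (m0 : Fin p → ℝ)
    (Q0 : Matrix (Fin p) (Fin p) ℝ) (ν : Measure (EuclideanSpace ℝ (Fin p))) :
    nuStar X y m0 Q0 (muStar X ν) = gaussianOf X y m0 Q0 (tilt X ν) := by
  rw [nuStar, precisionOf_muStar, gaussianOf]

theorem integral_dotProduct_sq_gaussianOf (X : Matrix (Fin n) (Fin p) ℝ) (y : Fin n → ℝ)
    (m0 : Fin p → ℝ) {Q0 : Matrix (Fin p) (Fin p) ℝ} (hQ0 : Q0.PosDef) (c : Fin n → ℝ)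
    (x : Fin p → ℝ) :
    ∫ β, (x ⬝ᵥ β.ofLp) ^ 2 ∂(gaussianOf X y m0 Q0 c) =
      x ⬝ᵥ (secondMoment X y m0 Q0 c *ᵥ x) := by
  rw [gaussianOf, integral_dotProduct_sq_multivariateGaussian _
    (precision_posDef X hQ0 (fun i => (phi_pos (c i)).le)).inv.posSemidef,
    dotProduct_secondMoment]

theorem wasserstein2_sq_gaussianOf_le (X : Matrix (Fin n) (Fin p) ℝ) (y : Fin n → ℝ)
    (m0 : Fin p → ℝ) {Q0 : Matrix (Fin p) (Fin p) ℝ} (hQ0 : Q0.PosDef) (c cs : Fin n → ℝ) :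
    wasserstein2 (precision X Q0 (fun i => phi (cs i)))
        (gaussianOf X y m0 Q0 c) (gaussianOf X y m0 Q0 cs) ^ 2 ≤
      ENNReal.ofReal (∑ i, (phi (c i) - phi (cs i)) ^ 2 / phi (cs i) *
        (X i ⬝ᵥ (secondMoment X y m0 Q0 c *ᵥ X i))) := by
  have hs := precision_posDef X hQ0 (fun i => (phi_pos (cs i)).le)
  have hc := precision_posDef X hQ0 (fun i => (phi_pos (c i)).le)
  refine (wasserstein2_sq_gaussian_le hs hc (shift X y m0 Q0)).trans (ENNReal.ofReal_le_ofReal ?_)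
  simp_rw [← integral_dotProduct_sq_gaussianOf X y m0 hQ0 c, ← integral_const_mul]
  have hint : ∀ i, Integrable (fun β : EuclideanSpace ℝ (Fin p) =>
      (phi (c i) - phi (cs i)) ^ 2 / phi (cs i) * (X i ⬝ᵥ β.ofLp) ^ 2) (gaussianOf X y m0 Q0 c) :=
    fun i => (memLp_dotProduct_multivariateGaussian _ _ _).integrable_sq.const_mul _
  rw [← integral_finsetSum _ fun i _ => hint i]
  refine integral_mono_of_nonneg
    (.of_forall fun β => dotProduct_mulVec_nonneg_of_posDef hs.inv _)
    (integrable_finsetSum _ fun i _ => hint i) (.of_forall fun β => ?_)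
  beta_reduce
  rw [precision_sub_mulVec]
  -- Pointwise in `β`, duality is applied with `u_i = (φ(c_i) - φ(cs_i)) x_iᵀ β` and weights
  -- `φ(cs_i)`; integrating turns `(x_iᵀ β)²` into `x_iᵀ S(c) x_i`.
  refine (dotProduct_precision_inv_le X hQ0 (fun i => phi_pos (cs i)) _).trans_eq ?_
  refine Finset.sum_congr rfl fun i _ => ?_
  rw [mul_pow]
  ring

/-! ### Increments of `φ`, the weights and the rate -/

/-- Minkowski's inequality in `L²`. -/
theorem abs_sqrt_integral_sq_sub_le {Ω : Type*} [MeasurableSpace Ω] {μ : Measure Ω} {f g : Ω → ℝ}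
    (hf : MemLp f 2 μ) (hg : MemLp g 2 μ) :
    |√(∫ a, f a ^ 2 ∂μ) - √(∫ a, g a ^ 2 ∂μ)| ≤ √(∫ a, (f a - g a) ^ 2 ∂μ) := by
  have key : ∀ {h : Ω → ℝ} (hh : MemLp h 2 μ), √(∫ a, h a ^ 2 ∂μ) = ‖hh.toLp h‖ := by
    intro h hh
    rw [Lp.norm_toLp, hh.eLpNorm_eq_integral_rpow_norm (by norm_num) (by norm_num),
      ENNReal.toReal_ofReal (by positivity), Real.sqrt_eq_rpow]
    simp
  have e := key (hf.sub hg)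
  simp only [Pi.sub_apply] at e
  rw [key hf, key hg, e, MemLp.toLp_sub]
  exact abs_norm_sub_norm_le _ _

theorem exists_mem_uIcc_deriv_eq {f : ℝ → ℝ} (hf : Differentiable ℝ f) (a b : ℝ) :
    ∃ ξ ∈ Set.uIcc a b, f b - f a = deriv f ξ * (b - a) := by
  rcases lt_trichotomy a b with h | h | h
  · obtain ⟨ξ, hξ, e⟩ := exists_deriv_eq_slope f h hf.continuous.continuousOn hf.differentiableOn
    refine ⟨ξ, Set.Icc_subset_uIcc (Set.Ioo_subset_Icc_self hξ), ?_⟩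
    rw [e, div_mul_cancel₀ _ (sub_ne_zero.2 h.ne')]
  · exact ⟨a, Set.left_mem_uIcc, by simp [h]⟩
  · obtain ⟨ξ, hξ, e⟩ := exists_deriv_eq_slope f h hf.continuous.continuousOn hf.differentiableOn
    refine ⟨ξ, Set.Icc_subset_uIcc' (Set.Ioo_subset_Icc_self hξ), ?_⟩
    have := sub_ne_zero.2 h.ne'
    rw [e]
    field_simp
    ring

/-- Ensures that the `sSup` in `weight` is a genuine supremum and not the default value `0` of an
unbounded set. -/
theorem bddAbove_weight_set (X : Matrix (Fin n) (Fin p) ℝ) (y : Fin n → ℝ) (m0 : Fin p → ℝ)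
    {Q0 : Matrix (Fin p) (Fin p) ℝ} (hQ0 : Q0.PosDef) (νs : Measure (EuclideanSpace ℝ (Fin p)))
    (ε : ℝ) (i : Fin n) :
    BddAbove {t : ℝ | ∃ ξ ∈ J X Q0 νs ε i, ∃ c : Fin n → ℝ, (∀ j, c j ∈ J X Q0 νs ε j) ∧
      t = |deriv phi ξ| ^ 2 * (X i ⬝ᵥ (secondMoment X y m0 Q0 c *ᵥ X i))} := by
  obtain ⟨K, hK⟩ := exists_dotProduct_secondMoment_le X y m0 hQ0 (X i)
  refine ⟨(1 / 2) ^ 2 * K, ?_⟩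
  rintro t ⟨ξ, -, c, -, rfl⟩
  have := dotProduct_secondMoment_nonneg X y m0 hQ0 c (X i)
  gcongr
  · exact abs_deriv_phi_le ξ
  · exact hK c

/-- The weights control the increments of `φ` on the box `∏ⱼ J_{j,ε}`. -/
theorem sq_phi_sub_mul_le_weight (X : Matrix (Fin n) (Fin p) ℝ) (y : Fin n → ℝ) (m0 : Fin p → ℝ)
    {Q0 : Matrix (Fin p) (Fin p) ℝ} (hQ0 : Q0.PosDef) {νs : Measure (EuclideanSpace ℝ (Fin p))}
    {ε : ℝ} {c : Fin n → ℝ} (hc : ∀ j, c j ∈ J X Q0 νs ε j) {i : Fin n}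
    (hi : tilt X νs i ∈ J X Q0 νs ε i) :
    (phi (c i) - phi (tilt X νs i)) ^ 2 / phi (tilt X νs i) *
        (X i ⬝ᵥ (secondMoment X y m0 Q0 c *ᵥ X i)) ≤
      weight X y m0 Q0 νs ε i * (c i - tilt X νs i) ^ 2 := by
  obtain ⟨ξ, hξ, e⟩ := exists_mem_uIcc_deriv_eq differentiable_phi (tilt X νs i) (c i)
  have hξJ : ξ ∈ J X Q0 νs ε i := Set.ordConnected_Icc.uIcc_subset hi (hc i) hξ
  have h := le_csSup (bddAbove_weight_set X y m0 hQ0 νs ε i) ⟨ξ, hξJ, c, hc, rfl⟩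
  have hp := phi_pos (tilt X νs i)
  rw [weight, e, mul_pow, ← sq_abs (deriv phi ξ)]
  calc _ = (|deriv phi ξ| ^ 2 * (X i ⬝ᵥ (secondMoment X y m0 Q0 c *ᵥ X i))) /
        phi (tilt X νs i) * (c i - tilt X νs i) ^ 2 := by ring
    _ ≤ _ := by gcongr

theorem weight_nonneg (X : Matrix (Fin n) (Fin p) ℝ) (y : Fin n → ℝ) (m0 : Fin p → ℝ)
    {Q0 : Matrix (Fin p) (Fin p) ℝ} (hQ0 : Q0.PosDef) (νs : Measure (EuclideanSpace ℝ (Fin p)))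
    (ε : ℝ) (i : Fin n) : 0 ≤ weight X y m0 Q0 νs ε i := by
  refine div_nonneg (Real.sSup_nonneg ?_) (phi_pos _).le
  rintro t ⟨ξ, -, c, -, rfl⟩
  exact mul_nonneg (sq_nonneg _) (dotProduct_secondMoment_nonneg X y m0 hQ0 c (X i))

theorem dotProduct_mulVec_le_lambdaMax {A : Matrix (Fin p) (Fin p) ℝ} (hA : A.IsHermitian)
    (w : Fin p → ℝ) : w ⬝ᵥ (A *ᵥ w) ≤ lambdaMax A * (w ⬝ᵥ w) := by
  have h : A ≤ algebraMap ℝ (Matrix (Fin p) (Fin p) ℝ) (lambdaMax A) := by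
    rw [le_algebraMap_iff_spectrum_le (ha := hA)]
    exact fun x hx => le_csSup A.finite_real_spectrum.bddAbove hx
  have h2 := (Matrix.le_iff.1 h).dotProduct_mulVec_nonneg w
  rw [sub_mulVec, dotProduct_sub, Algebra.algebraMap_eq_smul_one, smul_mulVec, one_mulVec,
    dotProduct_smul, smul_eq_mul, star_trivial] at h2
  linarith

theorem sum_weight_mul_le_rate (X : Matrix (Fin n) (Fin p) ℝ) (y : Fin n → ℝ) (m0 : Fin p → ℝ)
    {Q0 : Matrix (Fin p) (Fin p) ℝ} (νs : Measure (EuclideanSpace ℝ (Fin p))) (ε : ℝ)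
    (hs : (precisionStar X Q0 νs).PosDef) (v : EuclideanSpace ℝ (Fin p)) :
    ∑ i, weight X y m0 Q0 νs ε i * (X i ⬝ᵥ v.ofLp) ^ 2 ≤
      rate X y m0 Q0 νs ε * sqNormOf (precisionStar X Q0 νs) v := by
  set P := CFC.sqrt (precisionStar X Q0 νs)⁻¹ with hP
  have pP : P.PosDef := hs.inv.cfcSqrt
  have PP : P * P = (precisionStar X Q0 νs)⁻¹ := hs.inv.cfcSqrt_mul_self
  have PiPi : P⁻¹ * P⁻¹ = precisionStar X Q0 νs := by
    rw [← Matrix.mul_inv_rev, PP, nonsing_inv_nonsing_inv _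
      ((isUnit_iff_isUnit_det _).1 hs.isUnit)]
  set D := Xᵀ * diagonal (weight X y m0 Q0 νs ε) * X with hD
  have hA : rateMatrix X y m0 Q0 νs ε = P * D * P := by
    rw [rateMatrix, hD]
    simp only [Matrix.mul_assoc, hP]
  have hH : (rateMatrix X y m0 Q0 νs ε).IsHermitian := by
    rw [hA, IsHermitian, conjTranspose_eq_transpose_of_trivial, hD]
    simp only [transpose_mul, transpose_transpose, diagonal_transpose, pP.transpose_eq,
      Matrix.mul_assoc]
  -- The test vector `P⁻¹ v = Q⋆^{1/2} v` cancels the outer factors of `A_ε` and has squared length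
  -- `vᵀ Q⋆ v`.
  have h := dotProduct_mulVec_le_lambdaMax hH (P⁻¹ *ᵥ v.ofLp)
  rw [← dotProduct_mulVec_mul_self pP.inv.transpose_eq PiPi] at h
  have e : (P⁻¹ *ᵥ v.ofLp) ⬝ᵥ (rateMatrix X y m0 Q0 νs ε *ᵥ (P⁻¹ *ᵥ v.ofLp)) =
      v.ofLp ⬝ᵥ (D *ᵥ v.ofLp) := by
    rw [hA, ← mulVec_mulVec, mulVec_mulVec _ P, pP.mul_inv_self, one_mulVec, ← mulVec_mulVec,
      dotProduct_mulVec _ P, ← mulVec_transpose, pP.transpose_eq, mulVec_mulVec, pP.mul_inv_self,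
      one_mulVec]
  rw [e, hD, dotProduct_conj_diagonal] at h
  exact h

theorem tilt_nonneg (X : Matrix (Fin n) (Fin p) ℝ) (ν : Measure (EuclideanSpace ℝ (Fin p)))
    (i : Fin n) : 0 ≤ tilt X ν i :=
  Real.sqrt_nonneg _

/-! ### Tilts under couplings -/

section Coupling

variable {ν ρ : Measure (EuclideanSpace ℝ (Fin p))}
  {γ : Measure (EuclideanSpace ℝ (Fin p) × EuclideanSpace ℝ (Fin p))}

theorem memLp_fst_of_coupling (hγ : γ ∈ couplings ν ρ) {x : Fin p → ℝ}
    (hν : MemLp (fun β : EuclideanSpace ℝ (Fin p) => x ⬝ᵥ β.ofLp) 2 ν) :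
    MemLp (fun z : EuclideanSpace ℝ (Fin p) × EuclideanSpace ℝ (Fin p) => x ⬝ᵥ z.1.ofLp) 2 γ := by
  rw [← hγ.1, Measure.fst] at hν
  exact hν.comp_of_map measurable_fst.aemeasurable

theorem memLp_snd_of_coupling (hγ : γ ∈ couplings ν ρ) {x : Fin p → ℝ}
    (hρ : MemLp (fun β : EuclideanSpace ℝ (Fin p) => x ⬝ᵥ β.ofLp) 2 ρ) :
    MemLp (fun z : EuclideanSpace ℝ (Fin p) × EuclideanSpace ℝ (Fin p) => x ⬝ᵥ z.2.ofLp) 2 γ := by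
  rw [← hγ.2, Measure.snd] at hρ
  exact hρ.comp_of_map measurable_snd.aemeasurable

theorem integrable_dotProduct_sub_sq_of_coupling (hγ : γ ∈ couplings ν ρ) {x : Fin p → ℝ}
    (hν : MemLp (fun β : EuclideanSpace ℝ (Fin p) => x ⬝ᵥ β.ofLp) 2 ν)
    (hρ : MemLp (fun β : EuclideanSpace ℝ (Fin p) => x ⬝ᵥ β.ofLp) 2 ρ) :
    Integrable (fun z => (x ⬝ᵥ (z.1 - z.2).ofLp) ^ 2) γ := by
  simp_rw [WithLp.ofLp_sub, dotProduct_sub]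
  exact ((memLp_fst_of_coupling hγ hν).sub (memLp_snd_of_coupling hγ hρ)).integrable_sq

/-- Both tilts are `L²(γ)` norms, of `x_iᵀ z.1` and `x_iᵀ z.2`, so Minkowski applies. The coupling
is arbitrary, which lets the infimum be taken at the very end. -/
theorem tilt_sub_sq_le_of_coupling (X : Matrix (Fin n) (Fin p) ℝ) (hγ : γ ∈ couplings ν ρ)
    {i : Fin n} (hν : MemLp (fun β : EuclideanSpace ℝ (Fin p) => X i ⬝ᵥ β.ofLp) 2 ν)
    (hρ : MemLp (fun β : EuclideanSpace ℝ (Fin p) => X i ⬝ᵥ β.ofLp) 2 ρ) :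
    (tilt X ν i - tilt X ρ i) ^ 2 ≤ ∫ z, (X i ⬝ᵥ (z.1 - z.2).ofLp) ^ 2 ∂γ := by
  have h := abs_sqrt_integral_sq_sub_le (memLp_fst_of_coupling hγ hν) (memLp_snd_of_coupling hγ hρ)
  have e1 : ∫ z, (X i ⬝ᵥ z.1.ofLp) ^ 2 ∂γ = ∫ β, (X i ⬝ᵥ β.ofLp) ^ 2 ∂ν := by
    rw [← hγ.1, Measure.fst, integral_map measurable_fst.aemeasurable
      (Continuous.aestronglyMeasurable (by fun_prop))]
  have e2 : ∫ z, (X i ⬝ᵥ z.2.ofLp) ^ 2 ∂γ = ∫ β, (X i ⬝ᵥ β.ofLp) ^ 2 ∂ρ := by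
    rw [← hγ.2, Measure.snd, integral_map measurable_snd.aemeasurable
      (Continuous.aestronglyMeasurable (by fun_prop))]
  rw [e1, e2] at h
  simp_rw [WithLp.ofLp_sub, dotProduct_sub]
  rw [← sq_abs]
  calc _ ≤ √(∫ z, (X i ⬝ᵥ z.1.ofLp - X i ⬝ᵥ z.2.ofLp) ^ 2 ∂γ) ^ 2 := by gcongr; exact h
    _ = _ := Real.sq_sqrt (integral_nonneg fun z => sq_nonneg _)

theorem integrable_sqNormOf_of_lintegral_ne_top {B : Matrix (Fin p) (Fin p) ℝ} (hB : B.PosDef)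
    (h : ∫⁻ z, ENNReal.ofReal (sqNormOf B (z.1 - z.2)) ∂γ ≠ ∞) :
    Integrable (fun z => sqNormOf B (z.1 - z.2)) γ := by
  refine ⟨((measurable_sqNormOf B).comp
    (measurable_fst.sub measurable_snd)).aestronglyMeasurable, ?_⟩
  rw [hasFiniteIntegral_iff_ofReal (.of_forall fun z => sqNormOf_nonneg hB.posSemidef _)]
  exact h.lt_top

end Coupling

/-! ### Localisation and contraction of one step -/

section Contraction

variable {X : Matrix (Fin n) (Fin p) ℝ} {y : Fin n → ℝ} {m0 : Fin p → ℝ}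
  {Q0 : Matrix (Fin p) (Fin p) ℝ} {ν νs : Measure (EuclideanSpace ℝ (Fin p))} {ε : ℝ}

theorem precisionStar_posDef (hQ0 : Q0.PosDef) : (precisionStar X Q0 νs).PosDef := by
  rw [precisionStar, precisionOf_muStar]
  exact precision_posDef X hQ0 fun i => (phi_pos _).le

theorem tilt_self_mem_J (hε : 0 < ε) (i : Fin n) : tilt X νs i ∈ J X Q0 νs ε i := by
  have := mul_nonneg (Real.sqrt_nonneg (X i ⬝ᵥ ((precisionStar X Q0 νs)⁻¹ *ᵥ X i))) hε.le
  exact ⟨max_le (by linarith) (tilt_nonneg X νs i), by linarith⟩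

/-- The half-width of `J_{i,ε}` is the dual norm of `x_i` times `ε`. A coupling of cost below `ε²`
exists by definition of the infimum, so no optimal coupling is needed. -/
theorem tilt_mem_J (hQ0 : Q0.PosDef) (hε : 0 < ε)
    (hν : ∀ i, MemLp (fun β : EuclideanSpace ℝ (Fin p) => X i ⬝ᵥ β.ofLp) 2 ν)
    (hνs : ∀ i, MemLp (fun β : EuclideanSpace ℝ (Fin p) => X i ⬝ᵥ β.ofLp) 2 νs)
    (hW : wasserstein2 (precisionStar X Q0 νs) ν νs ^ 2 < ENNReal.ofReal (ε ^ 2)) (i : Fin n) :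
    tilt X ν i ∈ J X Q0 νs ε i := by
  have hs : (precisionStar X Q0 νs).PosDef := precisionStar_posDef hQ0
  rw [wasserstein2_sq] at hW
  obtain ⟨γ, hγ, hlt⟩ : ∃ γ ∈ couplings ν νs,
      ∫⁻ z, ENNReal.ofReal (sqNormOf (precisionStar X Q0 νs) (z.1 - z.2)) ∂γ <
        ENNReal.ofReal (ε ^ 2) := by simpa only [iInf_lt_iff, exists_prop] using hW
  have hint := integrable_sqNormOf_of_lintegral_ne_top hs (hlt.trans ENNReal.ofReal_lt_top).ne
  rw [← ofReal_integral_eq_lintegral_ofReal hint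
    (.of_forall fun z => sqNormOf_nonneg hs.posSemidef _),
    ENNReal.ofReal_lt_ofReal_iff (by positivity)] at hlt
  set s := X i ⬝ᵥ ((precisionStar X Q0 νs)⁻¹ *ᵥ X i) with hsdef
  have hs0 : 0 ≤ s := dotProduct_mulVec_nonneg_of_posDef hs.inv _
  have h1 : (tilt X ν i - tilt X νs i) ^ 2 ≤ (√s * ε) ^ 2 := by
    refine (tilt_sub_sq_le_of_coupling X hγ (hν i) (hνs i)).trans ?_
    rw [mul_pow, Real.sq_sqrt hs0]
    calc _ ≤ ∫ z, s * sqNormOf (precisionStar X Q0 νs) (z.1 - z.2) ∂γ :=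
          integral_mono (integrable_dotProduct_sub_sq_of_coupling hγ (hν i) (hνs i))
            (hint.const_mul s) fun z => dotProduct_sq_le_of_posDef hs _ _
      _ ≤ _ := by
        rw [integral_const_mul]
        gcongr
  have h2 := abs_le.1 (abs_le_of_sq_le_sq h1 (by positivity))
  exact ⟨max_le (by linarith [h2.1]) (tilt_nonneg X ν i), by linarith [h2.2]⟩

/-- One step of the scheme contracts the squared distance to the fixed point. -/
theorem wasserstein2_sq_step_le (hQ0 : Q0.PosDef)
    (hfix : νs = nuStar X y m0 Q0 (muStar X νs)) (hε : 0 < ε)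
    (hν : ∀ i, MemLp (fun β : EuclideanSpace ℝ (Fin p) => X i ⬝ᵥ β.ofLp) 2 ν)
    (hνs : ∀ i, MemLp (fun β : EuclideanSpace ℝ (Fin p) => X i ⬝ᵥ β.ofLp) 2 νs)
    (hW : wasserstein2 (precisionStar X Q0 νs) ν νs ^ 2 < ENNReal.ofReal (ε ^ 2)) :
    wasserstein2 (precisionStar X Q0 νs) (nuStar X y m0 Q0 (muStar X ν)) νs ^ 2 ≤
      ENNReal.ofReal (rate X y m0 Q0 νs ε) *
        wasserstein2 (precisionStar X Q0 νs) ν νs ^ 2 := by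
  have hs : (precisionStar X Q0 νs).PosDef := precisionStar_posDef hQ0
  have hJ := tilt_mem_J hQ0 hε hν hνs hW
  have hJs := tilt_self_mem_J (X := X) (Q0 := Q0) (νs := νs) hε
  have hstep : wasserstein2 (precisionStar X Q0 νs) (nuStar X y m0 Q0 (muStar X ν)) νs ^ 2 ≤
      ENNReal.ofReal (∑ i, weight X y m0 Q0 νs ε i * (tilt X ν i - tilt X νs i) ^ 2) := by
    have h := wasserstein2_sq_gaussianOf_le X y m0 hQ0 (tilt X ν) (tilt X νs)
    rw [← nuStar_muStar, ← nuStar_muStar, ← hfix, ← precisionOf_muStar] at h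
    exact h.trans (ENNReal.ofReal_le_ofReal (Finset.sum_le_sum fun i _ =>
      sq_phi_sub_mul_le_weight X y m0 hQ0 hJ (hJs i)))
  have hcoup : ∀ γ ∈ couplings ν νs,
      ∫⁻ z, ENNReal.ofReal (sqNormOf (precisionStar X Q0 νs) (z.1 - z.2)) ∂γ ≠ ∞ →
      ENNReal.ofReal (∑ i, weight X y m0 Q0 νs ε i * (tilt X ν i - tilt X νs i) ^ 2) ≤
        ENNReal.ofReal (rate X y m0 Q0 νs ε) *
          ∫⁻ z, ENNReal.ofReal (sqNormOf (precisionStar X Q0 νs) (z.1 - z.2)) ∂γ := by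
    intro γ hγ hfin
    have hint := integrable_sqNormOf_of_lintegral_ne_top hs hfin
    have hnn : ∀ z : EuclideanSpace ℝ (Fin p) × EuclideanSpace ℝ (Fin p),
        0 ≤ sqNormOf (precisionStar X Q0 νs) (z.1 - z.2) :=
      fun z => sqNormOf_nonneg hs.posSemidef _
    have hi : ∀ i, Integrable (fun z => weight X y m0 Q0 νs ε i *
        (X i ⬝ᵥ (z.1 - z.2).ofLp) ^ 2) γ := fun i =>
      (integrable_dotProduct_sub_sq_of_coupling hγ (hν i) (hνs i)).const_mul _
    -- `ENNReal.ofReal_mul'` asks only for a nonnegative cost, so the sign of the rate need not be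
    -- known.
    rw [← ofReal_integral_eq_lintegral_ofReal hint (.of_forall hnn),
      ← ENNReal.ofReal_mul' (integral_nonneg hnn)]
    apply ENNReal.ofReal_le_ofReal
    calc _ ≤ ∑ i, weight X y m0 Q0 νs ε i * ∫ z, (X i ⬝ᵥ (z.1 - z.2).ofLp) ^ 2 ∂γ :=
          Finset.sum_le_sum fun i _ => mul_le_mul_of_nonneg_left
            (tilt_sub_sq_le_of_coupling X hγ (hν i) (hνs i)) (weight_nonneg X y m0 hQ0 νs ε i)
      _ = ∫ z, ∑ i, weight X y m0 Q0 νs ε i * (X i ⬝ᵥ (z.1 - z.2).ofLp) ^ 2 ∂γ := by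
          rw [integral_finsetSum _ fun i _ => hi i]
          simp_rw [integral_const_mul]
      _ ≤ ∫ z, rate X y m0 Q0 νs ε * sqNormOf (precisionStar X Q0 νs) (z.1 - z.2) ∂γ :=
          integral_mono (integrable_finsetSum _ fun i _ => hi i) (hint.const_mul _)
            fun z => sum_weight_mul_le_rate X y m0 νs ε hs _
      _ = _ := integral_const_mul _ _
  refine hstep.trans ?_
  have hW' := (hW.trans ENNReal.ofReal_lt_top).ne
  -- Dividing by the rate isolates the infimum over couplings. A zero rate is admissible because the
  -- distance is finite; couplings of infinite cost are trivial.
  rw [mul_comm, ← ENNReal.div_le_iff_le_mul (Or.inr hW') (Or.inl ENNReal.ofReal_ne_top),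
    wasserstein2_sq]
  refine le_iInf₂ fun γ hγ => ?_
  by_cases hfin : ∫⁻ z, ENNReal.ofReal (sqNormOf (precisionStar X Q0 νs) (z.1 - z.2)) ∂γ = ∞
  · rw [hfin]
    exact le_top
  · rw [ENNReal.div_le_iff_le_mul (Or.inr hfin) (Or.inl ENNReal.ofReal_ne_top), mul_comm]
    exact hcoup γ hγ hfin

theorem memLp_dotProduct_nuStar (μ : Measure (Fin n → ℝ)) (x : Fin p → ℝ) :
    MemLp (fun β : EuclideanSpace ℝ (Fin p) => x ⬝ᵥ β.ofLp) 2 (nuStar X y m0 Q0 μ) :=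
  memLp_dotProduct_multivariateGaussian _ _ _

theorem memLp_dotProduct_of_mem_P2 (hν : ν ∈ P2 p) (x : Fin p → ℝ) :
    MemLp (fun β : EuclideanSpace ℝ (Fin p) => x ⬝ᵥ β.ofLp) 2 ν := by
  have h : MemLp (fun β : EuclideanSpace ℝ (Fin p) => β) 2 ν :=
    (memLp_two_iff_integrable_sq_norm (by fun_prop)).2 hν.2.2
  simp_rw [dotProduct_eq_inner]
  exact (innerSL ℝ (WithLp.toLp 2 x)).comp_memLp' h

end Contraction

end LogitCAVI

/-! ### Iteration of the contraction -/

theorem mainTheorem5 {n p : ℕ} (X : Matrix (Fin n) (Fin p) ℝ) (y : Fin n → ℝ)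
    (hy : ∀ i, y i = 0 ∨ y i = 1) (m0 : Fin p → ℝ)
    (Q0 : Matrix (Fin p) (Fin p) ℝ) (hQ0 : Q0.PosDef)
    (νs : Measure (EuclideanSpace ℝ (Fin p)))
    (hνs : νs = LogitCAVI.nuStar X y m0 Q0 (LogitCAVI.muStar X νs))
    (ε : ℝ) (hε : 0 < ε) (hr : LogitCAVI.rate X y m0 Q0 νs ε < 1)
    (ν0 : Measure (EuclideanSpace ℝ (Fin p)))
    (hν0 : ν0 ∈ LogitCAVI.ball (LogitCAVI.precisionStar X Q0 νs) νs ε) :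
    (∀ k : ℕ,
      LogitCAVI.wasserstein2 (LogitCAVI.precisionStar X Q0 νs)
          (LogitCAVI.iterate X y m0 Q0 ν0 (k + 1)) νs ^ 2 ≤
        ENNReal.ofReal (LogitCAVI.rate X y m0 Q0 νs ε) *
          LogitCAVI.wasserstein2 (LogitCAVI.precisionStar X Q0 νs)
            (LogitCAVI.iterate X y m0 Q0 ν0 k) νs ^ 2) ∧
    (∀ k : ℕ,
      LogitCAVI.wasserstein2 (LogitCAVI.precisionStar X Q0 νs)
          (LogitCAVI.iterate X y m0 Q0 ν0 k) νs ^ 2 ≤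
        ENNReal.ofReal (LogitCAVI.rate X y m0 Q0 νs ε) ^ k *
          LogitCAVI.wasserstein2 (LogitCAVI.precisionStar X Q0 νs) ν0 νs ^ 2) := by
  have hmemS : ∀ i, MemLp (fun β : EuclideanSpace ℝ (Fin p) => X i ⬝ᵥ β.ofLp) 2 νs := fun i => by
    rw [hνs]
    exact LogitCAVI.memLp_dotProduct_nuStar _ _
  have hmem : ∀ k i, MemLp (fun β : EuclideanSpace ℝ (Fin p) => X i ⬝ᵥ β.ofLp) 2
      (LogitCAVI.iterate X y m0 Q0 ν0 k) := by
    rintro (_ | k) i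
    · exact LogitCAVI.memLp_dotProduct_of_mem_P2 hν0.1 _
    · exact LogitCAVI.memLp_dotProduct_nuStar _ _
  -- The one-step estimate holds only inside the ball; a rate at most one makes the ball invariant.
  have hball : ∀ k, LogitCAVI.wasserstein2 (LogitCAVI.precisionStar X Q0 νs)
      (LogitCAVI.iterate X y m0 Q0 ν0 k) νs ^ 2 < ENNReal.ofReal (ε ^ 2) := by
    intro k
    induction k with
    | zero =>
      rw [ENNReal.ofReal_pow hε.le]
      exact ENNReal.pow_lt_pow_left two_ne_zero hν0.2
    | succ k ih =>
      refine lt_of_le_of_lt ?_ ih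
      refine (LogitCAVI.wasserstein2_sq_step_le hQ0 hνs hε (hmem k) hmemS ih).trans ?_
      exact mul_le_of_le_one_left' (ENNReal.ofReal_le_one.2 hr.le)
  have hstep : ∀ k, LogitCAVI.wasserstein2 (LogitCAVI.precisionStar X Q0 νs)
      (LogitCAVI.iterate X y m0 Q0 ν0 (k + 1)) νs ^ 2 ≤
      ENNReal.ofReal (LogitCAVI.rate X y m0 Q0 νs ε) *
        LogitCAVI.wasserstein2 (LogitCAVI.precisionStar X Q0 νs)
          (LogitCAVI.iterate X y m0 Q0 ν0 k) νs ^ 2 := fun k =>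
    LogitCAVI.wasserstein2_sq_step_le hQ0 hνs hε (hmem k) hmemS (hball k)
  refine ⟨hstep, fun k => ?_⟩
  induction k with
  | zero => rw [pow_zero, one_mul, LogitCAVI.iterate]
  | succ k ih =>
    refine (hstep k).trans ?_
    rw [pow_succ' (ENNReal.ofReal _), mul_assoc]
    gcongr
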